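/- Let $M$ be a connected manifold (of any dimension, compact or not, with or without boundary, orientable or not) with finitely generated fundamental group $\Gamma=\pi_1(M)$, and let $n\ge 1$. An $n$-fold covering of $M$ is a covering map $p\colon X\to M$ with $X$ connected and all fibres of cardinality $n$; two coverings $p\colon X\to M$, $p'\colon X'\to M$ are equivalent if there is a homeomorphism $h\colon X\to X'$ with $p'\circ h=p$. Then the number $N(n)$ of equivalence classes of $n$-fold coverings of $M$ is finite and $$N(n)=\frac1n\sum_{\ell m=n}\ \sum_{H\in\mathfrak H_m}\ \sum_{d\mid \ell}\mu\!\left(\frac{\ell}{d}\right)\,|\mathrm{Hom}(H,\mathbb Z_d)|\cdot M'_{H,\Gamma}(m),$$ where the outer sum is over pairs of positive integers $(\ell,m)$ with $\ell m=n$, $\mathfrak H_m$ is the set of isomorphism classes of groups arising as the first homology group $H_1(X;\mathbb Z)$ of $m$-fold coverings $X\to M$, $\mu$ is the Möbius function, $\mathrm{Hom}(H,\mathbb Z_d)$ is the set of homomorphisms from $H$ to the cyclic group $\mathbb Z_d$ of order $d$, and $M'_{H,\Gamma}(m)$ is the number of subgroups $F$ of index $m$ in $\Gamma$ with $H_1(F)=F/[F,F]$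 isomorphic to $H$. All the sets counted or summed over are finite: for $m\mid n$ the set $\mathfrak H_m$ and the set of subgroups of index $m$ in $\Gamma$ are finite, and $\mathrm{Hom}(H,\mathbb Z_d)$ is finite for all $H\in\mathfrak H_m$ and $d\ge1$. -/

import Mathlib

open CategoryTheory

universe u

/-- A (connected, unbranched) `n`-fold covering of `M`: a connected space with a covering map
onto `M` all of whose fibres have exactly `n` points. An `n`-fold covering has
the cardinality of `M × Fin n` at most, so there is no loss in taking total spaces in the
universe of `M`. -/
structure NFoldCovering (M : Type u) [TopologicalSpace M] (n : ℕ) where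
  /-- The total space. -/
  Total : Type u
  /-- The topology of the total space. -/
  [top : TopologicalSpace Total]
  /-- The total space is connected (in particular non-empty). -/
  [connected : ConnectedSpace Total]
  /-- The projection. -/
  proj : Total → M
  isCoveringMap : IsCoveringMap proj
  encard_fibre : ∀ x : M, (proj ⁻¹' {x}).encard = n

attribute [instance] NFoldCovering.top NFoldCovering.connected

namespace NFoldCovering

variable {M : Type u} [TopologicalSpace M] {n : ℕ}

/-- Two coverings are equivalent if there is a homeomorphism between the total spaces that
commutes with the projections. -/
def Equivalent (p q : NFoldCovering M n) : Prop :=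
  ∃ h : p.Total ≃ₜ q.Total, ∀ e : p.Total, q.proj (h e) = p.proj e

theorem equivalent_equivalence :
    Equivalence (Equivalent : NFoldCovering M n → NFoldCovering M n → Prop) where
  refl p := ⟨Homeomorph.refl _, fun _ => rfl⟩
  symm := by
    rintro p q ⟨h, hh⟩
    refine ⟨h.symm, fun e => ?_⟩
    rw [← hh, h.apply_symm_apply]
  trans := by
    rintro p q r ⟨h, hh⟩ ⟨k, hk⟩
    exact ⟨h.trans k, fun e => by rw [← hh, ← hk]; rfl⟩

/-- Equivalence of `n`-fold coverings as a setoid. -/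
def setoid (M : Type u) [TopologicalSpace M] (n : ℕ) : Setoid (NFoldCovering M n) :=
  ⟨Equivalent, equivalent_equivalence⟩

end NFoldCovering

/-- The equivalence classes of `n`-fold coverings of `M`. -/
def CoveringClass (M : Type u) [TopologicalSpace M] (n : ℕ) : Type (u + 1) :=
  Quotient (NFoldCovering.setoid M n)

/-- The number `N(n)` of non-equivalent `n`-fold coverings of `M`. -/
noncomputable def numCoverings (M : Type u) [TopologicalSpace M] (n : ℕ) : ℕ :=
  Nat.card (CoveringClass M n)

/-- The first (singular) homology group `H₁(X; ℤ)` of a topological space. -/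
noncomputable def firstHomology (X : Type u) [TopologicalSpace X] : AddCommGrpCat.{u} :=
  ((AlgebraicTopology.singularHomologyFunctor AddCommGrpCat.{u} 1).obj
    (AddCommGrpCat.of (ULift.{u} ℤ))).obj (TopCat.of X)

/-- Isomorphism classes of abelian groups. -/
def AbGroupClass : Type (u + 1) :=
  Quotient (isIsomorphicSetoid AddCommGrpCat.{u})

/-- The isomorphism class of an abelian group. -/
def AbGroupClass.mk (A : AddCommGrpCat.{u}) : AbGroupClass.{u} :=
  Quotient.mk (isIsomorphicSetoid AddCommGrpCat.{u}) A

/-- A group in the given isomorphism class. -/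
noncomputable def AbGroupClass.rep (H : AbGroupClass.{u}) : AddCommGrpCat.{u} :=
  Quotient.out H

/-- The set of groups (up to isomorphism) that arise as first homology groups of `m`-fold
coverings of `M`. -/
def coveringHomologies (M : Type u) [TopologicalSpace M] (m : ℕ) : Set AbGroupClass.{u} :=
  Set.range fun p : NFoldCovering M m => AbGroupClass.mk (firstHomology p.Total)

/-- The number `M'_{H,Γ}(m)` of subgroups `F` of index `m` in `Γ` whose first homology group
`F / [F, F]` is isomorphic to `H`. -/
noncomputable def numSubgroupsWithHomology (Γ : Type u) [Group Γ] (H : AddCommGrpCat.{u})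
    (m : ℕ) : ℕ :=
  Nat.card {F : Subgroup Γ // F.index = m ∧ Nonempty (Additive (Abelianization F) ≃+ H)}

/-! Over a locally path connected, semilocally simply connected connected space, `n`-fold coverings
up to equivalence are conjugacy classes of index-`n` subgroups of Γ
(`nonempty_coveringClass_equiv`). A manifold is such a space: its charts map to a convex set, where
straight-line homotopies are available.

To count the classes, note that `K` has [Γ : N(K)] conjugates and that |N(K)/K|·[Γ : N(K)] = n, so n
times the number of classes is Σ_K |N(K)/K|. Sort the elements of N(K)/K by order. An element `q` of
order `l` amounts to a pair (F, φ), with F the preimage of ⟨q⟩ and φ : F → Z_l the surjection with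
kernel K and q ↦ 1 (`nonempty_cyclicExtension_equiv`). Here F has index m = n/l, and K is recovered
as ker φ, so the total is Σ_{lm=n} Σ_F |Epi(F, Z_l)|, with F running over the subgroups of index m
(`card_conj_index_eq_sum`).

Since Z_l is abelian, Epi(F, Z_l) depends only on F/[F,F]. Sorting homomorphisms by image gives
|Hom(A, Z_l)| = Σ_{d∣l} |Epi(A, Z_d)|, which Möbius inversion solves for Epi. Grouping the F by the
class of F/[F,F] gives the formula.

The groups F/[F,F] are the first homology groups of the coverings by the Hurewicz isomorphism. It is
proved in chains modulo boundaries C₁/B₁, where every path, closed or not, has a class additive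
under concatenation; H₁ is the kernel of ∂ there. -/

/-! ### Finiteness of the set of subgroups of given index -/

section FiniteIndexSubgroups

variable {G : Type*} [Group G]

/-- A finitely generated group has finitely many homomorphisms to a finite monoid. -/
theorem MonoidHom.finite_of_fg {P : Type*} [Monoid P] [Finite P] [hG : Group.FG G] :
    Finite (G →* P) := by
  obtain ⟨S, hS, hfin⟩ := Group.fg_iff.1 hG
  have := hfin.to_subtype
  refine Finite.of_injective (fun (f : G →* P) (s : S) => f s) fun f g hfg => ?_
  exact MonoidHom.eq_of_eqOn_top (hS ▸ MonoidHom.eqOn_closure (fun s hs => congrFun hfg ⟨s, hs⟩))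

/-- A finitely generated group has finitely many subgroups of a given finite index. -/
theorem Subgroup.finite_setOf_index_eq [Group.FG G] {m : ℕ} (hm : m ≠ 0) :
    {F : Subgroup G | F.index = m}.Finite := by
  have := MonoidHom.finite_of_fg (G := G) (P := Equiv.Perm (Fin m))
  -- Labelling the cosets of `F` by `Fin m` makes `F` a point stabilizer of an action on `Fin m`;
  -- there are finitely many pairs (action, point).
  have : ∀ F : {F : Subgroup G | F.index = m}, ∃ f : (G →* Equiv.Perm (Fin m)) × Fin m,
      (F : Subgroup G) = {g | f.1 g f.2 = f.2} := by
    rintro ⟨F, hF⟩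
    have : Finite (G ⧸ F) := Nat.finite_of_card_ne_zero (by rw [← Subgroup.index]; simp_all)
    let e : G ⧸ F ≃ Fin m := Finite.equivFinOfCardEq hF
    refine ⟨⟨e.permCongrHom.toMonoidHom.comp (MulAction.toPermHom G (G ⧸ F)), e (1 : G)⟩, ?_⟩
    ext g
    have : ((g : G) : G ⧸ F) = ((1 : G) : G ⧸ F) ↔ g ∈ F := by
      rw [eq_comm, QuotientGroup.eq]; simp
    simp [Equiv.permCongrHom, Equiv.permCongr_apply, this]
  choose f hf using this
  exact Finite.of_injective f fun F F' h => Subtype.ext <| SetLike.coe_injective <| by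
    rw [hf F, hf F', h]

end FiniteIndexSubgroups

/-! ### Epimorphisms onto cyclic groups and Möbius inversion -/

section CountingEpimorphisms

/-- By Lagrange `S` lies in this kernel, which has gcd(|C|, |S|) ≤ |S| elements. So a subgroup of a
finite cyclic group is determined by its order. -/
theorem AddSubgroup.eq_ker_nsmul_of_card {C : Type*} [AddCommGroup C] [IsAddCyclic C] [Finite C]
    (S : AddSubgroup C) : S = (nsmulAddMonoidHom (Nat.card S) : C →+ C).ker := by
  refine AddSubgroup.eq_of_le_of_card_ge (fun x hx => ?_) ?_
  · have := card_nsmul_eq_zero' (x := (⟨x, hx⟩ : S))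
    exact congrArg Subtype.val this
  · rw [IsAddCyclic.card_nsmulAddMonoidHom_ker]
    exact Nat.gcd_le_right _ Nat.card_pos

variable {A : Type*} [AddCommGroup A]

/-- Homomorphisms to a finite cyclic group with image of order `d` correspond to surjections to
the cyclic group of order `d`. -/
theorem card_addMonoidHom_card_range_eq {l d : ℕ} (hl : l ≠ 0) (hd : d ∣ l) :
    Nat.card {φ : A →+ ZMod l // Nat.card φ.range = d} =
      Nat.card {ψ : A →+ ZMod d // Function.Surjective ψ} := by
  have : NeZero l := ⟨hl⟩
  have hd0 : d ≠ 0 := ne_zero_of_dvd_ne_zero hl hd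
  let K : AddSubgroup (ZMod l) := (nsmulAddMonoidHom d : ZMod l →+ ZMod l).ker
  have hK : Nat.card K = d := by
    rw [IsAddCyclic.card_nsmulAddMonoidHom_ker, Nat.card_zmod, Nat.gcd_eq_right hd]
  have hZ : Nat.card (ZMod d) = d := Nat.card_zmod d
  let e : ZMod d ≃+ K := addEquivOfAddCyclicCardEq (hZ.trans hK.symm)
  symm
  refine Nat.card_congr (Equiv.ofBijective
    (fun ψ => ⟨K.subtype.comp (e.toAddMonoidHom.comp ψ.1), ?_⟩)
    ⟨fun ψ ψ' h => ?_, fun φ => ?_⟩)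
  · have : (K.subtype.comp (e.toAddMonoidHom.comp ψ.1)).range = K := by
      ext x
      constructor
      · rintro ⟨a, rfl⟩
        exact (e (ψ.1 a)).2
      · intro hx
        obtain ⟨a, ha⟩ := ψ.2 (e.symm ⟨x, hx⟩)
        exact ⟨a, by simp [ha]⟩
    rw [this, hK]
  · ext a
    have := DFunLike.congr_fun (congrArg Subtype.val h) a
    exact e.injective (Subtype.ext this)
  · obtain ⟨φ, hφ⟩ := φ
    have hr : φ.range = K := by rw [AddSubgroup.eq_ker_nsmul_of_card φ.range, hφ]
    let φ' : A →+ K := φ.codRestrict K fun a => hr ▸ ⟨a, rfl⟩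
    refine ⟨⟨e.symm.toAddMonoidHom.comp φ', fun z => ?_⟩, ?_⟩
    · obtain ⟨a, ha⟩ : (e z : ZMod l) ∈ φ.range := by
        rw [hr]; exact (e z).2
      exact ⟨a, e.injective (by simpa [φ'] using Subtype.ext ha)⟩
    · ext a
      simp [φ']

/-- Sort the homomorphisms by the order of their image, a divisor of `l`. -/
theorem card_addMonoidHom_zmod {l : ℕ} (hl : l ≠ 0) [Finite (A →+ ZMod l)] :
    Nat.card (A →+ ZMod l) =
      ∑ d ∈ l.divisors, Nat.card {ψ : A →+ ZMod d // Function.Surjective ψ} := by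
  classical
  have : NeZero l := ⟨hl⟩
  have := Fintype.ofFinite (A →+ ZMod l)
  rw [Nat.card_eq_fintype_card, ← Finset.card_univ,
    Finset.card_eq_sum_card_fiberwise (f := fun φ : A →+ ZMod l => Nat.card φ.range)
      (t := l.divisors)]
  · refine Finset.sum_congr rfl fun d hd => ?_
    rw [← card_addMonoidHom_card_range_eq hl (Nat.dvd_of_mem_divisors hd),
      Nat.card_eq_fintype_card, Fintype.card_subtype]
  · intro φ _
    have := φ.range.card_addSubgroup_dvd_card
    rw [Nat.card_zmod] at this
    simpa [hl] using this

/-- The number of surjections to a finite cyclic group, by Möbius inversion. -/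
theorem sum_moebius_mul_card_addMonoidHom {l : ℕ} (hl : 0 < l)
    (hfin : ∀ d : ℕ, 1 ≤ d → Finite (A →+ ZMod d)) :
    ∑ d ∈ l.divisors, (ArithmeticFunction.moebius (l / d) : ℚ) * (Nat.card (A →+ ZMod d) : ℚ) =
      Nat.card {ψ : A →+ ZMod l // Function.Surjective ψ} := by
  have := (ArithmeticFunction.sum_eq_iff_sum_mul_moebius_eq (R := ℚ)
    (f := fun l => Nat.card {ψ : A →+ ZMod l // Function.Surjective ψ})
    (g := fun l => Nat.card (A →+ ZMod l))).1 (fun n hn => by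
      have := hfin n hn
      rw [card_addMonoidHom_zmod hn.ne']
      push_cast
      rfl) l hl
  rw [← this, Nat.sum_divisorsAntidiagonal'
    (f := fun a b => (ArithmeticFunction.moebius a : ℚ) * (Nat.card (A →+ ZMod b) : ℚ))]

end CountingEpimorphisms

/-! ### Mednykh's count of conjugacy classes of subgroups -/

section Mednykh

variable {G : Type*} [Group G]

open Subgroup
open scoped Pointwise

/-- The quotient of the normalizer of `K` by `K`. -/
abbrev NormalizerQuotient (K : Subgroup G) : Type _ :=
  normalizer (K : Set G) ⧸ K.subgroupOf (normalizer (K : Set G))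

/-- Subgroups of `G` with a surjection to the cyclic group of order `l`, with kernel `K`. -/
abbrev CyclicExtension (K : Subgroup G) (l : ℕ) : Type _ :=
  {t : (F : Subgroup G) × (F →* Multiplicative (ZMod l)) //
    Function.Surjective t.2 ∧ t.2.ker.map t.1.subtype = K}

theorem mem_normalizer_map_ker {P : Type*} [Group P] {F : Subgroup G} (φ : F →* P) (g : F) :
    (g : G) ∈ normalizer (φ.ker.map F.subtype : Set G) := by
  rw [mem_normalizer_iff]
  intro h
  constructor
  · rintro ⟨k, hk, rfl⟩
    exact ⟨g * k * g⁻¹, (φ.normal_ker).conj_mem k hk g, by simp⟩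
  · rintro ⟨k, hk, hkg⟩
    refine ⟨g⁻¹ * k * g⁻¹⁻¹, (φ.normal_ker).conj_mem k hk g⁻¹, ?_⟩
    simp only [subtype_apply] at hkg
    simp [hkg, mul_assoc]

theorem mem_map_ker_iff {P : Type*} [Group P] {F : Subgroup G} (φ : F →* P) (g : F) :
    (g : G) ∈ φ.ker.map F.subtype ↔ φ g = 1 := by
  simp [mem_map, MonoidHom.mem_ker]

/-- Subgroups with a surjection to the cyclic group of order `l` with kernel `K` correspond to
elements of order `l` in `N(K) / K`. -/
theorem nonempty_cyclicExtension_equiv (K : Subgroup G) {l : ℕ} (hl : l ≠ 0) :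
    Nonempty (CyclicExtension K l ≃ {q : NormalizerQuotient K // orderOf q = l}) := by
  have : NeZero l := ⟨hl⟩
  have hgen : ∀ t : CyclicExtension K l, ∃ g : t.1.1, t.1.2 g = Multiplicative.ofAdd 1 :=
    fun t => t.2.1 _
  choose gen hgen using hgen
  have hN : ∀ t : CyclicExtension K l, (gen t : G) ∈ normalizer (K : Set G) := by
    intro t
    have := mem_normalizer_map_ker t.1.2 (gen t)
    rwa [t.2.2] at this
  have hmem : ∀ (t : CyclicExtension K l) (g : t.1.1), (g : G) ∈ K ↔ t.1.2 g = 1 := by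
    intro t g
    rw [← mem_map_ker_iff, t.2.2]
  have hle : ∀ (t : CyclicExtension K l), K ≤ t.1.1 := by
    intro t
    conv_lhs => rw [← t.2.2]
    exact map_subtype_le _
  -- Preimages of 1 under φ form a single coset of K = ker φ, and they normalize `K`.
  let cls : CyclicExtension K l → NormalizerQuotient K := fun t =>
    QuotientGroup.mk ⟨gen t, hN t⟩
  have hpow : ∀ (t : CyclicExtension K l) (i : ℤ),
      t.1.2 (gen t ^ i) = Multiplicative.ofAdd (i : ZMod l) := by
    intro t i
    rw [map_zpow, hgen, ← ofAdd_zsmul]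
    simp
  have hord : ∀ t, orderOf (cls t) = l := by
    intro t
    refine Nat.dvd_antisymm (orderOf_dvd_of_pow_eq_one ?_) ?_
    · rw [← QuotientGroup.mk_pow, QuotientGroup.eq_one_iff, mem_subgroupOf]
      have := hpow t l
      simp only [zpow_natCast, Int.cast_natCast, CharP.cast_eq_zero, ofAdd_zero] at this
      simpa using (hmem t _).2 this
    · have h := pow_orderOf_eq_one (cls t)
      rw [← QuotientGroup.mk_pow, QuotientGroup.eq_one_iff, mem_subgroupOf] at h
      have h2 := (hmem t (gen t ^ orderOf (cls t))).1 (by simpa using h)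
      have := hpow t (orderOf (cls t))
      rw [zpow_natCast, h2] at this
      have h3 : ((orderOf (cls t) : ℕ) : ZMod l) = 0 := by
        simpa using (congrArg Multiplicative.toAdd this).symm
      exact (ZMod.natCast_eq_zero_iff _ _).1 h3
  -- `F` is the union of the cosets of `K` by powers of the generator, so it can be rebuilt from
  -- `cls t`.
  have hmemF : ∀ (t : CyclicExtension K l) (x : G),
      x ∈ t.1.1 ↔ ∃ i : ℤ, (gen t : G) ^ i * x ∈ K := by
    intro t x
    constructor
    · intro hx
      obtain ⟨i, hi⟩ := ZMod.intCast_surjective (t.1.2 ⟨x, hx⟩).toAdd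
      refine ⟨-i, (hmem t (gen t ^ (-i) * ⟨x, hx⟩)).2 ?_⟩
      rw [map_mul, hpow]
      apply Multiplicative.toAdd.injective
      simp [← hi]
    · rintro ⟨i, hi⟩
      have := hle t hi
      rwa [mul_mem_cancel_left] at this
      exact zpow_mem (gen t).2 i
  refine Nonempty.intro (Equiv.ofBijective (fun t => ⟨cls t, hord t⟩) ⟨fun t t' h => ?_, ?_⟩)
  -- Injectivity: generators in the same coset of `K` generate the same `F` over `K` and have the
  -- same image 1, which fixes φ.
  · have h1 : (gen t : G)⁻¹ * gen t' ∈ K := by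
      have := QuotientGroup.eq.1 (congrArg Subtype.val h : cls t = cls t')
      simpa [mem_subgroupOf] using this
    have hg' : (gen t' : G) ∈ t.1.1 := by
      have := mul_mem (gen t).2 (hle t h1)
      simpa using this
    have hg'v : t.1.2 ⟨gen t', hg'⟩ = Multiplicative.ofAdd 1 := by
      have := (hmem t ((gen t)⁻¹ * ⟨gen t', hg'⟩)).1 h1
      rw [map_mul, map_inv, hgen, inv_mul_eq_one] at this
      exact this.symm
    have hpow' : ∀ (i : ℤ) (x : t.1.1), (gen t' : G) ^ i * x ∈ K ↔
        t.1.2 x = Multiplicative.ofAdd (-i : ZMod l) := by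
      intro i x
      rw [show (gen t' : G) ^ i * x = ((⟨gen t', hg'⟩ ^ i * x : t.1.1) : G) by simp, hmem,
        map_mul, map_zpow, hg'v, ← ofAdd_zsmul, mul_eq_one_iff_eq_inv']
      simp
    have hF : t.1.1 = t'.1.1 := by
      ext x
      rw [hmemF t']
      constructor
      · intro hx
        obtain ⟨i, hi⟩ := ZMod.intCast_surjective (t.1.2 ⟨x, hx⟩).toAdd
        refine ⟨-i, (hpow' (-i) ⟨x, hx⟩).2 ?_⟩
        simp [hi]
      · rintro ⟨i, hi⟩
        have := hle t hi
        rwa [mul_mem_cancel_left] at this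
        exact zpow_mem hg' i
    have hφ : ∀ (x : G) (hx : x ∈ t.1.1) (hx' : x ∈ t'.1.1),
        t.1.2 ⟨x, hx⟩ = t'.1.2 ⟨x, hx'⟩ := by
      intro x hx hx'
      obtain ⟨i, hi⟩ := (hmemF t' x).1 hx'
      rw [(hpow' i ⟨x, hx⟩).1 hi]
      have := (hmem t' (gen t' ^ i * ⟨x, hx'⟩)).1 hi
      rw [map_mul, hpow, mul_eq_one_iff_eq_inv'] at this
      rw [this]; rfl
    obtain ⟨⟨F, φ⟩, ht⟩ := t
    obtain ⟨⟨F', φ'⟩, ht'⟩ := t'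
    obtain rfl : F = F' := hF
    congr 2
    ext x
    exact hφ x x.2 x.2
  · rintro ⟨q, hq⟩
    -- Surjectivity: `F` is the preimage of ⟨q⟩ in N(K), and φ is F → ⟨q⟩ ≅ Z_l with q ↦ 1. The map
    -- `j` only views `F` inside N(K).
    let N := normalizer (K : Set G)
    let π : N →* NormalizerQuotient K := QuotientGroup.mk' _
    let F₀ : Subgroup N := (zpowers q).comap π
    let F : Subgroup G := F₀.map N.subtype
    let j : F →* F₀ := (F₀.equivMapOfInjective N.subtype N.subtype_injective).symm.toMonoidHom
    have hj : ∀ x : F, ((j x : N) : G) = x := fun x => by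
      have := (F₀.equivMapOfInjective N.subtype N.subtype_injective).apply_symm_apply x
      exact congrArg Subtype.val this
    let ρ : F →* zpowers q := (π.subgroupComap (zpowers q)).comp j
    have hgenq : ∀ x : zpowers q, x ∈ zpowers (⟨q, mem_zpowers q⟩ : zpowers q) := by
      rintro ⟨x, i, rfl⟩
      exact ⟨i, Subtype.ext (by simp)⟩
    let e : Multiplicative (ZMod l) ≃* zpowers q :=
      zmodMulEquivOfGenerator hgenq ((Nat.card_zpowers q).trans hq)
    have he : e (Multiplicative.ofAdd 1) = ⟨q, mem_zpowers q⟩ :=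
      zmodMulEquivOfGenerator_apply_ofAdd_one ..
    have hρ : Function.Surjective ρ := by
      rintro ⟨x, hx⟩
      obtain ⟨y, rfl⟩ := QuotientGroup.mk'_surjective _ x
      refine ⟨⟨y, y, hx, rfl⟩, Subtype.ext ?_⟩
      change π (j _ : N) = π y
      congr 1
      exact Subtype.ext (hj _)
    have hKN : K ≤ N := le_normalizer
    let t : CyclicExtension K l := ⟨⟨F, e.symm.toMonoidHom.comp ρ⟩,
      e.symm.surjective.comp hρ, by
        ext x
        constructor
        · rintro ⟨y, hy, rfl⟩
          have hy1 : ρ y = 1 := by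
            have : e.symm (ρ y) = 1 := hy
            simpa using this
          have hy2 : π (j y : N) = 1 := congrArg Subtype.val hy1
          have := (QuotientGroup.eq_one_iff _).1 hy2
          rw [mem_subgroupOf, hj] at this
          exact this
        · intro hx
          have hx1 : π ⟨x, hKN hx⟩ = 1 := (QuotientGroup.eq_one_iff _).2 (mem_subgroupOf.2 hx)
          have hxF : x ∈ F := ⟨⟨x, hKN hx⟩, by
            change π _ ∈ zpowers q
            rw [hx1]; exact one_mem _, rfl⟩
          refine ⟨⟨x, hxF⟩, ?_, rfl⟩
          have : ρ ⟨x, hxF⟩ = 1 := by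
            apply Subtype.ext
            change π (j _ : N) = 1
            rw [← hx1]
            congr 1
            exact Subtype.ext (hj _)
          change e.symm (ρ ⟨x, hxF⟩) = 1
          rw [this, map_one]⟩
    refine ⟨t, Subtype.ext ?_⟩
    have h1 : e.symm (ρ (gen t)) = Multiplicative.ofAdd 1 := hgen t
    have h2 : ρ (gen t) = ⟨q, mem_zpowers q⟩ := by rw [← he, ← h1, e.apply_symm_apply]
    have h3 : π (j (gen t) : N) = q := congrArg Subtype.val h2
    change π _ = q
    rw [← h3]
    congr 1
    exact Subtype.ext (hj _).symm

theorem card_normalizerQuotient_mul_index (K : Subgroup G) :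
    Nat.card (NormalizerQuotient K) * (normalizer (K : Set G)).index = K.index :=
  relIndex_mul_index (H := K) le_normalizer

theorem finite_normalizerQuotient {K : Subgroup G} (hK : K.index ≠ 0) :
    Finite (NormalizerQuotient K) :=
  Nat.finite_of_card_ne_zero fun h => hK <| by
    rw [← card_normalizerQuotient_mul_index, h, zero_mul]

/-- Elements of N(K)/K are sorted by order, which divides |N(K)/K| and hence `n`. -/
theorem sum_card_cyclicExtension {n : ℕ} (hn : n ≠ 0) {K : Subgroup G} (hK : K.index = n) :
    ∑ l ∈ n.divisors, Nat.card (CyclicExtension K l) = Nat.card (NormalizerQuotient K) := by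
  classical
  have := finite_normalizerQuotient (hK ▸ hn)
  have := Fintype.ofFinite (NormalizerQuotient K)
  rw [Nat.card_eq_fintype_card, ← Finset.card_univ,
    Finset.card_eq_sum_card_fiberwise (f := orderOf) (t := n.divisors)]
  · refine Finset.sum_congr rfl fun l hl => ?_
    obtain ⟨e⟩ := nonempty_cyclicExtension_equiv K (Nat.pos_of_mem_divisors hl).ne'
    rw [Nat.card_congr e, Nat.card_eq_fintype_card, Fintype.card_subtype]
  · intro q _
    have h1 := orderOf_dvd_natCard q
    have h2 : Nat.card (NormalizerQuotient K) ∣ n :=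
      ⟨_, (hK.symm.trans (card_normalizerQuotient_mul_index K).symm)⟩
    simpa [hn] using h1.trans h2

theorem index_map_ker {F : Subgroup G} {l : ℕ} {φ : F →* Multiplicative (ZMod l)}
    (hφ : Function.Surjective φ) : (φ.ker.map F.subtype).index = l * F.index := by
  rw [index_map_subtype, index_ker, MonoidHom.range_eq_top.2 hφ, card_top]
  exact congrArg (· * _) (Nat.card_zmod l)

/-- Surjections from a subgroup of index `m` to the cyclic group of order `l`, grouped by
kernel. -/
noncomputable def sigmaCyclicExtensionEquiv {l m n : ℕ} (h : l * m = n) (hl : l ≠ 0) :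
    (Σ K : {K : Subgroup G // K.index = n}, CyclicExtension K.1 l) ≃
      Σ F : {F : Subgroup G // F.index = m},
        {φ : F.1 →* Multiplicative (ZMod l) // Function.Surjective φ} where
  toFun x := ⟨⟨x.2.1.1, Nat.eq_of_mul_eq_mul_left (Nat.pos_of_ne_zero hl) <| by
      rw [← index_map_ker x.2.2.1, x.2.2.2, x.1.2, h]⟩, x.2.1.2, x.2.2.1⟩
  invFun x := ⟨⟨x.2.1.ker.map x.1.1.subtype, by rw [index_map_ker x.2.2, x.1.2, h]⟩,
    ⟨⟨x.1.1, x.2.1⟩, x.2.2, rfl⟩⟩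
  left_inv := by
    rintro ⟨⟨K, hK⟩, ⟨⟨F, φ⟩, hφ⟩⟩
    -- `K` is redundant, being the kernel.
    obtain rfl : φ.ker.map F.subtype = K := hφ.2
    rfl
  right_inv _ := rfl

/-- The target is abelian, and surjectivity is unaffected because F → F/[F,F] is onto. -/
theorem card_surjective_additive_abelianization (F : Type*) [Group F] (l : ℕ) :
    Nat.card {φ : F →* Multiplicative (ZMod l) // Function.Surjective φ} =
      Nat.card {ψ : Additive (Abelianization F) →+ ZMod l // Function.Surjective ψ} := by
  refine Nat.card_congr (Equiv.subtypeEquiv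
    (Abelianization.lift.trans MonoidHom.toAdditiveLeft) fun φ => ?_)
  constructor
  · intro h z
    obtain ⟨x, hx⟩ := h (Multiplicative.ofAdd z)
    refine ⟨Additive.ofMul (Abelianization.of x), ?_⟩
    simp [hx]
  · intro h z
    obtain ⟨x, hx⟩ := h z.toAdd
    obtain ⟨y, hy⟩ := QuotientGroup.mk_surjective x.toMul
    refine ⟨y, Multiplicative.toAdd.injective ?_⟩
    rw [← hx, show x = Additive.ofMul (Abelianization.of y) from congrArg Additive.ofMul hy.symm]
    simp

/-- Conjugacy of subgroups of index `n`. -/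
def conjIndexSetoid (G : Type*) [Group G] (n : ℕ) : Setoid {K : Subgroup G // K.index = n} :=
  letI := MulAction.compHom (Subgroup G) (MulAut.conj : G →* MulAut G)
  (MulAction.orbitRel G (Subgroup G)).comap Subtype.val

theorem conjIndexSetoid_iff {n : ℕ} {K K' : {K : Subgroup G // K.index = n}} :
    conjIndexSetoid G n K K' ↔ ∃ g : G, K'.1.map (MulAut.conj g).toMonoidHom = K.1 :=
  Iff.rfl

/-- Orbit–stabilizer for conjugation: the stabilizer of `K` is its normalizer, and [N(K) : K]·[G :
N(K)] = n. -/
theorem card_normalizerQuotient_mul_card_conj {n : ℕ} (K : {K : Subgroup G // K.index = n}) :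
    Nat.card (NormalizerQuotient K.1) * Nat.card {K' // conjIndexSetoid G n K' K} = n := by
  let := MulAction.compHom (Subgroup G) (MulAut.conj : G →* MulAut G)
  have hsmul : ∀ (g : G) (L : Subgroup G), g • L = L.map (MulAut.conj g).toMonoidHom :=
    fun _ _ => rfl
  have hst : MulAction.stabilizer G K.1 = normalizer (K.1 : Set G) := by
    ext g
    rw [MulAction.mem_stabilizer_iff, mem_normalizer_iff, hsmul]
    constructor
    · intro h x
      conv_rhs => rw [← h]
      simp [mem_map]
    · intro h
      ext x
      rw [mem_map]
      constructor
      · rintro ⟨y, hy, rfl⟩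
        exact (h y).1 hy
      · intro hx
        refine ⟨g⁻¹ * x * g, (h _).2 ?_, ?_⟩
        · simpa [mul_assoc] using hx
        · simp [mul_assoc]
  have hindex : ∀ L ∈ MulAction.orbit G K.1, L.index = n := by
    rintro _ ⟨g, rfl⟩
    change (K.1.map (MulAut.conj g).toMonoidHom).index = n
    exact (index_map_equiv _ (MulAut.conj g)).trans K.2
  have hcard : Nat.card {K' // conjIndexSetoid G n K' K} = (MulAction.orbit G K.1).ncard := by
    rw [← Nat.card_coe_set_eq]
    exact Nat.card_congr ⟨fun x => ⟨x.1.1, x.2⟩, fun x => ⟨⟨x.1, hindex _ x.2⟩, x.2⟩,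
      fun _ => rfl, fun _ => rfl⟩
  rw [hcard, ← MulAction.index_stabilizer, hst, card_normalizerQuotient_mul_index, K.2]

/-- Each conjugacy class contributes `n` in total. -/
theorem sum_card_normalizerQuotient {n : ℕ}
    [Fintype {K : Subgroup G // K.index = n}] :
    ∑ K : {K : Subgroup G // K.index = n}, Nat.card (NormalizerQuotient K.1) =
      n * Nat.card (Quotient (conjIndexSetoid G n)) := by
  classical
  have := Fintype.ofFinite (Quotient (conjIndexSetoid G n))
  rw [← Finset.sum_fiberwise (g := Quotient.mk (conjIndexSetoid G n)),
    Finset.sum_congr rfl (g := fun _ => n), Finset.sum_const, Finset.card_univ,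
    Nat.card_eq_fintype_card, smul_eq_mul, mul_comm]
  intro c _
  induction c using Quotient.inductionOn with | _ K
  let s := Finset.univ.filter fun K' => Quotient.mk (conjIndexSetoid G n) K' = Quotient.mk _ K
  have hs : ∀ K', K' ∈ s ↔ conjIndexSetoid G n K' K := fun K' => by
    simp only [s, Finset.mem_filter_univ, Quotient.eq]
  have hcard : ∀ K' ∈ s, Nat.card {L // conjIndexSetoid G n L K'} = s.card := by
    intro K' hK'
    rw [Nat.card_eq_fintype_card, Fintype.card_subtype]
    congr 1
    ext L
    rw [hs, Finset.mem_filter_univ]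
    exact ⟨fun h => (conjIndexSetoid G n).trans h ((hs K').1 hK'),
      fun h => (conjIndexSetoid G n).trans h ((conjIndexSetoid G n).symm ((hs K').1 hK'))⟩
  have hpos : 0 < s.card := Finset.card_pos.2 ⟨K, (hs K).2 ((conjIndexSetoid G n).refl K)⟩
  -- After multiplication by the size of the class every term becomes `n`, so no division is needed.
  refine Nat.eq_of_mul_eq_mul_right hpos ?_
  change (∑ K' ∈ s, _) * _ = _
  rw [Finset.sum_mul, Finset.sum_congr rfl (g := fun _ => n), Finset.sum_const, smul_eq_mul,
    mul_comm]
  intro K' hK'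
  rw [← hcard K' hK', card_normalizerQuotient_mul_card_conj]

/-- Mednykh's formula for the number of conjugacy classes of subgroups of index `n`. -/
theorem card_conj_index_eq_sum [Group.FG G] {n : ℕ} (hn : n ≠ 0) :
    n * Nat.card (Quotient (conjIndexSetoid G n)) =
      ∑ lm ∈ n.divisorsAntidiagonal, ∑ᶠ F : {F : Subgroup G // F.index = lm.2},
        Nat.card {ψ : Additive (Abelianization F.1) →+ ZMod lm.1 // Function.Surjective ψ} := by
  have hfin : ∀ m : ℕ, m ≠ 0 → Finite {K : Subgroup G // K.index = m} :=
    fun m hm => (finite_setOf_index_eq hm).to_subtype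
  have := hfin n hn
  have := Fintype.ofFinite {K : Subgroup G // K.index = n}
  rw [← sum_card_normalizerQuotient,
    ← Finset.sum_congr rfl fun K _ => sum_card_cyclicExtension hn K.2, Finset.sum_comm,
    ← Nat.sum_divisorsAntidiagonal (f := fun l _ => ∑ K : {K : Subgroup G // K.index = n},
      Nat.card (CyclicExtension K.1 l))]
  refine Finset.sum_congr rfl fun lm hlm => ?_
  obtain ⟨l, m⟩ := lm
  obtain ⟨hlm, -⟩ := Nat.mem_divisorsAntidiagonal.1 hlm
  have hl : l ≠ 0 := by rintro rfl; simp at hlm; exact hn hlm.symm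
  have hm : m ≠ 0 := by rintro rfl; simp at hlm; exact hn hlm.symm
  have := hfin m hm
  have := Fintype.ofFinite {K : Subgroup G // K.index = m}
  have hfinQ : ∀ K : {K : Subgroup G // K.index = n}, Finite (CyclicExtension K.1 l) := by
    intro K
    have := finite_normalizerQuotient (K := K.1) (K.2.symm ▸ hn)
    obtain ⟨e⟩ := nonempty_cyclicExtension_equiv K.1 hl
    exact Finite.of_equiv _ e.symm
  have hfinF : ∀ F : {F : Subgroup G // F.index = m},
      Finite {φ : F.1 →* Multiplicative (ZMod l) // Function.Surjective φ} := by
    intro F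
    -- Epi(F, Z_l) embeds in the finite set of pairs (K, cyclic extension).
    exact Finite.of_injective
      (fun φ => (sigmaCyclicExtensionEquiv (G := G) hlm hl).symm ⟨F, φ⟩)
      ((Equiv.injective _).comp sigma_mk_injective)
  rw [finsum_eq_sum_of_fintype, ← Nat.card_sigma,
    Nat.card_congr (sigmaCyclicExtensionEquiv hlm hl), Nat.card_sigma]
  exact Finset.sum_congr rfl fun F _ => card_surjective_additive_abelianization _ _

end Mednykh

/-! ### First simplicial homology inside one-chains modulo boundaries -/

section SimplicialHomology

open Limits Simplicial

variable (S : SSet.{u})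

/-- The integral simplicial chain complex. -/
noncomputable abbrev SSet.intChains : ChainComplex AddCommGrpCat.{u} ℕ :=
  S.chainComplex (AddCommGrpCat.of (ULift.{u} ℤ))

namespace SSet

variable {S}

/-- The basis chain attached to a simplex. -/
noncomputable def chain {n : ℕ} (s : S _⦋n⦌) : (S.intChains).X n :=
  (S.ιChainComplex (R := AddCommGrpCat.of (ULift.{u} ℤ)) s).hom (ULift.up 1 : ULift.{u} ℤ)

theorem uliftInt_hom_ext {A : AddCommGrpCat.{u}} {f g : AddCommGrpCat.of (ULift.{u} ℤ) ⟶ A}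
    (h : f (ULift.up 1 : ULift.{u} ℤ) = g (ULift.up 1 : ULift.{u} ℤ)) : f = g := by
  ext ⟨x⟩
  have : (ULift.up x : ULift.{u} ℤ) = x • (ULift.up 1 : ULift.{u} ℤ) := by
    apply ULift.ext
    simp
  erw [this, map_zsmul, map_zsmul, h]

theorem intChains_hom_ext {n : ℕ} {A : AddCommGrpCat.{u}} {f g : (S.intChains).X n ⟶ A}
    (h : ∀ s : S _⦋n⦌, f (chain s) = g (chain s)) : f = g :=
  chainComplex_hom_ext fun s => uliftInt_hom_ext (h s)

/-- The homomorphism on chains with prescribed values on simplices. -/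
noncomputable def chainDesc {n : ℕ} {A : AddCommGrpCat.{u}} (f : S _⦋n⦌ → A) :
    (S.intChains).X n ⟶ A :=
  Sigma.desc fun s => AddCommGrpCat.ofHom (uliftZMultiplesHom A (f s))

theorem chainDesc_chain {n : ℕ} {A : AddCommGrpCat.{u}} (f : S _⦋n⦌ → A) (s : S _⦋n⦌) :
    chainDesc f (chain s) = f s := by
  have h : S.ιChainComplex s ≫ chainDesc f = AddCommGrpCat.ofHom (uliftZMultiplesHom A (f s)) :=
    Sigma.ι_desc ..
  have := ConcreteCategory.congr_hom h (ULift.up 1 : ULift.{u} ℤ)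
  refine this.trans ?_
  change (1 : ℤ) • f s = f s
  rw [one_zsmul]

theorem d_chain {n : ℕ} (s : S _⦋n + 1⦌) :
    (S.intChains).d (n + 1) n (chain s) =
      ∑ i : Fin (n + 2), (-1 : ℤ) ^ i.val • chain (S.δ i s) := by
  let ev : (AddCommGrpCat.of (ULift.{u} ℤ) ⟶ (S.intChains).X n) →+ (S.intChains).X n :=
    { toFun f := f.hom (ULift.up 1 : ULift.{u} ℤ), map_zero' := rfl, map_add' _ _ := rfl }
  exact (congrArg ev (S.ιChainComplex_d (AddCommGrpCat.of (ULift.{u} ℤ)) s)).trans (map_sum ev _ _)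

variable (S) in
/-- One-chains modulo boundaries. -/
noncomputable abbrev OneChainClasses : AddCommGrpCat.{u} := (S.intChains).opcycles 1

/-- The class of a `1`-simplex modulo boundaries. -/
noncomputable def edgeClass (s : S _⦋1⦌) : OneChainClasses S := (S.intChains).pOpcycles 1 (chain s)

/-- The boundary δ₀ − δ₁ + δ₂ of `t` vanishes modulo boundaries. -/
theorem edgeClass_add (t : S _⦋2⦌) :
    edgeClass (S.δ 2 t) + edgeClass (S.δ 0 t) = edgeClass (S.δ 1 t) := by
  have h := ConcreteCategory.congr_hom ((S.intChains).d_pOpcycles 2 1) (chain t)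
  rw [ConcreteCategory.comp_apply, d_chain t, Fin.sum_univ_three] at h
  simp only [Fin.val_zero, Fin.val_one, Fin.val_two, pow_zero, pow_one, one_smul, neg_smul,
    even_two, Even.neg_pow, one_pow, map_add, map_neg] at h
  have h' : edgeClass (S.δ 0 t) + -edgeClass (S.δ 1 t) + edgeClass (S.δ 2 t) = 0 := h
  rw [← sub_eq_zero, ← h']
  abel

theorem d_comp_chainDesc {A : AddCommGrpCat.{u}} (f : S _⦋1⦌ → A)
    (hf : ∀ t : S _⦋2⦌, f (S.δ 2 t) + f (S.δ 0 t) = f (S.δ 1 t)) :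
    (S.intChains).d 2 1 ≫ chainDesc f = 0 :=
  intChains_hom_ext fun t => by
    rw [ConcreteCategory.comp_apply, d_chain t, Fin.sum_univ_three]
    simp only [Fin.val_zero, Fin.val_one, Fin.val_two, pow_zero, pow_one, one_smul, neg_smul,
      even_two, Even.neg_pow, one_pow, map_add, map_neg, chainDesc_chain]
    rw [← hf t]
    change _ = (0 : A)
    abel

/-- The homomorphism on one-chains modulo boundaries attached to a cocycle. -/
noncomputable def edgeClassDesc {A : AddCommGrpCat.{u}} (f : S _⦋1⦌ → A)
    (hf : ∀ t : S _⦋2⦌, f (S.δ 2 t) + f (S.δ 0 t) = f (S.δ 1 t)) : OneChainClasses S ⟶ A :=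
  (S.intChains).descOpcycles (chainDesc f) 2 (by simp) (d_comp_chainDesc f hf)

theorem edgeClassDesc_edgeClass {A : AddCommGrpCat.{u}} (f : S _⦋1⦌ → A)
    (hf : ∀ t : S _⦋2⦌, f (S.δ 2 t) + f (S.δ 0 t) = f (S.δ 1 t)) (s : S _⦋1⦌) :
    edgeClassDesc f hf (edgeClass s) = f s :=
  (ConcreteCategory.congr_hom ((S.intChains).p_descOpcycles (chainDesc f) 2 (by simp)
    (d_comp_chainDesc f hf)) (chain s)).trans (chainDesc_chain f s)

theorem oneChainClasses_hom_ext {A : AddCommGrpCat.{u}} {f g : OneChainClasses S ⟶ A}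
    (h : ∀ s : S _⦋1⦌, f (edgeClass s) = g (edgeClass s)) : f = g := by
  rw [← cancel_epi ((S.intChains).pOpcycles 1)]
  exact intChains_hom_ext h

variable (S) in
/-- The boundary of one-chains modulo boundaries. -/
noncomputable abbrev edgeBoundary : OneChainClasses S ⟶ (S.intChains).X 0 :=
  (S.intChains).fromOpcycles 1 0

theorem edgeBoundary_edgeClass (s : S _⦋1⦌) :
    edgeBoundary S (edgeClass s) = chain (S.δ 0 s) - chain (S.δ 1 s) := by
  have h := ConcreteCategory.congr_hom ((S.intChains).p_fromOpcycles 1 0) (chain s)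
  rw [ConcreteCategory.comp_apply, d_chain s, Fin.sum_univ_two] at h
  refine h.trans ?_
  simp [sub_eq_add_neg]

variable (S) in
/-- The first homology group is the kernel of the boundary on one-chains modulo boundaries. -/
noncomputable def homologyOneEquiv :
    (S.intChains).homology 1 ≃+ (edgeBoundary S).hom.ker :=
  let e : (S.intChains).homology 1 ≅ AddCommGrpCat.of (edgeBoundary S).hom.ker :=
    (((S.intChains).homologyIsKernel 1 0 (by simp)).conePointUniqueUpToIso
      (AddCommGrpCat.kernelIsLimit (edgeBoundary S)))
  e.addCommGroupIsoToAddEquiv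

/-- If `χ` splits the cocycle-induced homomorphism `ψ` up to the boundary, the first homology is
the source of `χ`. -/
theorem nonempty_addEquiv_homology_one {A : AddCommGrpCat.{u}} (f : S _⦋1⦌ → A)
    (hf : ∀ t : S _⦋2⦌, f (S.δ 2 t) + f (S.δ 0 t) = f (S.δ 1 t)) (χ : A ⟶ OneChainClasses S)
    (hχ : ∀ a, edgeBoundary S (χ a) = 0) (hχf : ∀ a, edgeClassDesc f hf (χ a) = a)
    (c : S _⦋0⦌ → OneChainClasses S)
    (hc : ∀ s : S _⦋1⦌, χ (f s) = c (S.δ 1 s) + edgeClass s - c (S.δ 0 s)) :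
    Nonempty (A ≃+ (S.intChains).homology 1) := by
  -- On generators `hc` reads χψ = id − c∂. On cycles the last term vanishes, so χ maps onto them;
  -- it is injective by `hχf`.
  have key : ∀ z : OneChainClasses S,
      χ (edgeClassDesc f hf z) = z - chainDesc c (edgeBoundary S z) := by
    intro z
    have : edgeClassDesc f hf ≫ χ = 𝟙 _ - edgeBoundary S ≫ chainDesc c := by
      refine oneChainClasses_hom_ext fun s => ?_
      rw [ConcreteCategory.comp_apply, edgeClassDesc_edgeClass, hc]
      change _ = edgeClass s - chainDesc c (edgeBoundary S (edgeClass s))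
      rw [edgeBoundary_edgeClass, map_sub, chainDesc_chain, chainDesc_chain]
      abel
    exact ConcreteCategory.congr_hom this z
  refine ⟨AddEquiv.trans (AddEquiv.ofBijective
    (χ.hom.codRestrict (edgeBoundary S).hom.ker hχ) ⟨fun a b h => ?_, fun z => ?_⟩)
    (homologyOneEquiv S).symm⟩
  · rw [← hχf a, ← hχf b]
    exact congrArg _ (congrArg Subtype.val h)
  · refine ⟨edgeClassDesc f hf z.1, Subtype.ext ?_⟩
    have hz : edgeBoundary S z.1 = 0 := z.2
    refine (key z.1).trans ?_
    rw [hz, map_zero, sub_zero]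

end SSet

end SimplicialHomology

/-! ### The Hurewicz isomorphism in degree one -/

section Hurewicz

open Simplicial unitInterval

/-- The `i`-th edge of the standard two-simplex. -/
noncomputable def simplexEdge (i : Fin 3) : C(I, stdSimplex ℝ (Fin 3)) where
  toFun r := stdSimplex.map i.succAbove (stdSimplexHomeomorphUnitInterval.symm r)
  continuous_toFun := (stdSimplex.continuous_map _).comp (Homeomorph.continuous _)

theorem simplexEdge_apply (i j : Fin 3) (r : I) :
    simplexEdge i r j =
      (if i.succAbove 0 = j then 1 - (r : ℝ) else 0) +
        (if i.succAbove 1 = j then (r : ℝ) else 0) := by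
  have h0 : stdSimplexHomeomorphUnitInterval.symm r 0 = 1 - (r : ℝ) := rfl
  have h1 : stdSimplexHomeomorphUnitInterval.symm r 1 = (r : ℝ) := rfl
  rw [← h0, ← h1]
  refine (congrFun (stdSimplex.map_coe i.succAbove _) j).trans ?_
  rw [FunOnFinite.linearMap_apply_apply, Finset.sum_filter, Fin.sum_univ_two]

theorem simplexEdge_zero (r : I) (j : Fin 3) :
    simplexEdge 0 r j = (![0, 1 - (r : ℝ), r] : Fin 3 → ℝ) j := by
  rw [simplexEdge_apply]
  fin_cases j <;> simp [Fin.ext_iff]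

theorem simplexEdge_one (r : I) (j : Fin 3) :
    simplexEdge 1 r j = (![1 - (r : ℝ), 0, r] : Fin 3 → ℝ) j := by
  rw [simplexEdge_apply]
  fin_cases j <;> simp [Fin.ext_iff, Fin.succAbove]

theorem simplexEdge_two (r : I) (j : Fin 3) :
    simplexEdge 2 r j = (![1 - (r : ℝ), r, 0] : Fin 3 → ℝ) j := by
  rw [simplexEdge_apply]
  fin_cases j <;> simp [Fin.ext_iff, Fin.succAbove, Fin.lt_def]

variable {X : Type u} [TopologicalSpace X]

/-- A point as a singular `0`-simplex. -/
noncomputable def singularPoint (x : X) : (TopCat.toSSet.obj (TopCat.of X)) _⦋0⦌ :=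
  TopCat.toSSetObj₀Equiv.symm x

/-- A parametrized curve as a singular `1`-simplex. -/
noncomputable def singularCurve (f : C(I, X)) : (TopCat.toSSet.obj (TopCat.of X)) _⦋1⦌ :=
  (TopCat.toSSetObjEquiv (TopCat.of X) (.op ⦋1⦌)).symm
    (f.comp ⟨stdSimplexHomeomorphUnitInterval, Homeomorph.continuous _⟩)

/-- A map from the standard two-simplex as a singular `2`-simplex. -/
noncomputable def singularTriangle (t : C(stdSimplex ℝ (Fin 3), X)) :
    (TopCat.toSSet.obj (TopCat.of X)) _⦋2⦌ :=
  (TopCat.toSSetObjEquiv (TopCat.of X) (.op ⦋2⦌)).symm t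

theorem singularCurve_surjective : Function.Surjective (singularCurve (X := X)) := by
  intro s
  refine ⟨(TopCat.toSSetObjEquiv (TopCat.of X) (.op ⦋1⦌) s).comp
    ⟨stdSimplexHomeomorphUnitInterval.symm, Homeomorph.continuous _⟩, ?_⟩
  rw [singularCurve, Equiv.symm_apply_eq]
  ext z
  simp

theorem singularTriangle_surjective : Function.Surjective (singularTriangle (X := X)) :=
  Equiv.surjective _

theorem δ_singularTriangle (i : Fin 3) (t : C(stdSimplex ℝ (Fin 3), X)) :
    (TopCat.toSSet.obj (TopCat.of X)).δ i (singularTriangle t) =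
      singularCurve (t.comp (simplexEdge i)) := by
  apply (TopCat.toSSetObjEquiv (TopCat.of X) (.op ⦋1⦌)).injective
  ext z
  refine (TopCat.toSSetObjEquiv_δ_apply _ i z).trans ?_
  simp [singularTriangle, singularCurve, simplexEdge]

theorem δ_one_singularCurve (f : C(I, X)) :
    (TopCat.toSSet.obj (TopCat.of X)).δ 1 (singularCurve f) = singularPoint (f 0) := by
  rw [singularPoint, Equiv.eq_symm_apply]
  change f (stdSimplexHomeomorphUnitInterval
    (stdSimplex.map (Fin.succAbove 1) (default : stdSimplex ℝ (Fin 1)))) = f 0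
  rw [Subsingleton.elim default (stdSimplex.vertex 0), stdSimplex.map_vertex]
  exact congrArg f stdSimplexHomeomorphUnitInterval_zero

theorem δ_zero_singularCurve (f : C(I, X)) :
    (TopCat.toSSet.obj (TopCat.of X)).δ 0 (singularCurve f) = singularPoint (f 1) := by
  rw [singularPoint, Equiv.eq_symm_apply]
  change f (stdSimplexHomeomorphUnitInterval
    (stdSimplex.map (Fin.succAbove 0) (default : stdSimplex ℝ (Fin 1)))) = f 1
  rw [Subsingleton.elim default (stdSimplex.vertex 0), stdSimplex.map_vertex]
  exact congrArg f stdSimplexHomeomorphUnitInterval_one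

open SSet

theorem edgeClass_triangle (t : C(stdSimplex ℝ (Fin 3), X)) :
    edgeClass (singularCurve (t.comp (simplexEdge 2))) +
      edgeClass (singularCurve (t.comp (simplexEdge 0))) =
    edgeClass (singularCurve (t.comp (simplexEdge 1))) := by
  simpa only [δ_singularTriangle] using edgeClass_add (singularTriangle t)

theorem edgeClass_triangle_of_eq (t : C(stdSimplex ℝ (Fin 3), X)) {f g h : C(I, X)}
    (h₂ : ∀ r, t (simplexEdge 2 r) = f r) (h₀ : ∀ r, t (simplexEdge 0 r) = g r)
    (h₁ : ∀ r, t (simplexEdge 1 r) = h r) :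
    edgeClass (singularCurve f) + edgeClass (singularCurve g) = edgeClass (singularCurve h) := by
  have := edgeClass_triangle t
  rwa [show t.comp (simplexEdge 2) = f from ContinuousMap.ext h₂,
    show t.comp (simplexEdge 0) = g from ContinuousMap.ext h₀,
    show t.comp (simplexEdge 1) = h from ContinuousMap.ext h₁] at this

/-- The constant triangle gives e + e = e. -/
theorem edgeClass_const (x : X) : edgeClass (singularCurve (ContinuousMap.const I x)) = 0 := by
  have := edgeClass_triangle_of_eq (ContinuousMap.const _ x) (f := .const I x) (g := .const I x)
    (h := .const I x) (fun _ => rfl) (fun _ => rfl) (fun _ => rfl)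
  simpa using this

theorem edgeClass_trans {a b c : X} (p : Path a b) (q : Path b c) :
    edgeClass (singularCurve (p.trans q : C(I, X))) =
      edgeClass (singularCurve (p : C(I, X))) + edgeClass (singularCurve (q : C(I, X))) := by
  -- The affine map taking the vertices to 0, 1/2, 1: its edges traverse the first half, the second
  -- half and all of `p.trans q`. `projIcc` only adjusts the codomain.
  let φ : C(stdSimplex ℝ (Fin 3), I) :=
    ⟨fun z => Set.projIcc 0 1 zero_le_one (z 1 / 2 + z 2), by
      refine continuous_projIcc.comp ?_
      exact (((continuous_apply 1).comp continuous_subtype_val).div_const 2).add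
        ((continuous_apply 2).comp continuous_subtype_val)⟩
  have hφ : ∀ z, (φ z : ℝ) = max 0 (min 1 (z 1 / 2 + z 2)) := fun z => rfl
  refine (edgeClass_triangle_of_eq ((p.trans q : C(I, X)).comp φ) (fun r => ?_) (fun r => ?_)
    (fun r => ?_)).symm
  · have h : (φ (simplexEdge 2 r) : ℝ) = r / 2 := by
      rw [hφ, simplexEdge_two, simplexEdge_two]
      have := r.2.1
      have := r.2.2
      simp
      rw [min_eq_right (by linarith), max_eq_right (by linarith)]
    change p.trans q (φ (simplexEdge 2 r)) = p r
    rw [Path.trans_apply, dif_pos (by rw [h]; linarith [r.2.2])]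
    congr 1
    ext
    simp only [h]
    ring
  · have h : (φ (simplexEdge 0 r) : ℝ) = (1 + r) / 2 := by
      rw [hφ, simplexEdge_zero, simplexEdge_zero]
      have := r.2.1
      have := r.2.2
      simp
      rw [min_eq_right (by linarith), max_eq_right (by linarith)]
      ring
    change p.trans q (φ (simplexEdge 0 r)) = q r
    rw [Path.trans_apply]
    split_ifs with h'
    · have hr : r = 0 := by
        rw [h] at h'
        exact Subtype.ext (le_antisymm (by simpa using by linarith) r.2.1)
      subst hr
      rw [q.source]
      convert p.target
      rw [h]
      simp
    · congr 1
      ext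
      simp only [h]
      ring
  · change p.trans q (φ (simplexEdge 1 r)) = p.trans q r
    congr 1
    ext
    rw [hφ, simplexEdge_one, simplexEdge_one]
    have := r.2.1
    have := r.2.2
    simp [*]

/-- Cut the square of the homotopy along its diagonal. The two triangles share the diagonal; their
other edges are `p`, `q` and two constant paths. -/
theorem edgeClass_eq_of_homotopic {a b : X} {p q : Path a b} (h : p.Homotopic q) :
    edgeClass (singularCurve (p : C(I, X))) = edgeClass (singularCurve (q : C(I, X))) := by
  obtain ⟨F⟩ := h
  have hc : ∀ j : Fin 3, Continuous fun z : stdSimplex ℝ (Fin 3) => z j :=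
    fun j => (continuous_apply j).comp continuous_subtype_val
  -- On vertices α is 0, 0, 1 and β is 0, 1, 1, so (α, β) and (β, α) parametrize the two halves of
  -- the square.
  let α : C(stdSimplex ℝ (Fin 3), I) :=
    ⟨fun z => Set.projIcc 0 1 zero_le_one (z 2), continuous_projIcc.comp (hc 2)⟩
  let β : C(stdSimplex ℝ (Fin 3), I) :=
    ⟨fun z => Set.projIcc 0 1 zero_le_one (z 1 + z 2),
      continuous_projIcc.comp ((hc 1).add (hc 2))⟩
  have hα2 : ∀ r, α (simplexEdge 2 r) = 0 := fun r => by
    simp [α, simplexEdge_two]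
  have hα0 : ∀ r, α (simplexEdge 0 r) = r := fun r => by
    simp [α, simplexEdge_zero]
  have hα1 : ∀ r, α (simplexEdge 1 r) = r := fun r => by
    simp [α, simplexEdge_one]
  have hβ2 : ∀ r, β (simplexEdge 2 r) = r := fun r => by
    simp [β, simplexEdge_two]
  have hβ0 : ∀ r, β (simplexEdge 0 r) = 1 := fun r => by
    simp [β, simplexEdge_zero]
  have hβ1 : ∀ r, β (simplexEdge 1 r) = r := fun r => by
    simp [β, simplexEdge_one]
  let diag : C(I, X) := ⟨fun r => F (r, r), by fun_prop⟩
  have h1 := edgeClass_triangle_of_eq (F.toContinuousMap.comp (α.prodMk β)) (f := p)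
    (g := .const I b) (h := diag)
    (fun r => by
      change F (α _, β _) = _
      rw [hα2, hβ2]; exact F.apply_zero r)
    (fun r => by
      change F (α _, β _) = _
      rw [hα0, hβ0]; exact F.target r)
    (fun r => by
      change F (α _, β _) = _
      rw [hα1, hβ1]; rfl)
  have h2 := edgeClass_triangle_of_eq (F.toContinuousMap.comp (β.prodMk α)) (f := .const I a)
    (g := q) (h := diag)
    (fun r => by
      change F (β _, α _) = _
      rw [hα2, hβ2]; exact F.source r)
    (fun r => by
      change F (β _, α _) = _
      rw [hα0, hβ0]; exact F.apply_one r)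
    (fun r => by
      change F (β _, α _) = _
      rw [hα1, hβ1]; rfl)
  rw [edgeClass_const, add_zero] at h1
  rw [edgeClass_const, zero_add] at h2
  rw [h1, h2]

/-- The class of a homotopy class of paths in one-chains modulo boundaries. -/
noncomputable def pathClass {a b : X} (γ : Path.Homotopic.Quotient a b) :
    OneChainClasses (TopCat.toSSet.obj (TopCat.of X)) :=
  Quotient.lift (fun p : Path a b => edgeClass (singularCurve (p : C(I, X))))
    (fun _ _ h => edgeClass_eq_of_homotopic h) γ

theorem pathClass_trans {a b c : X} (γ : Path.Homotopic.Quotient a b)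
    (δ : Path.Homotopic.Quotient b c) : pathClass (γ.trans δ) = pathClass γ + pathClass δ := by
  induction γ using Quotient.inductionOn with | _ p
  induction δ using Quotient.inductionOn with | _ q
  exact edgeClass_trans p q

theorem pathClass_refl (a : X) : pathClass (.refl a) = 0 := edgeClass_const a

theorem pathClass_symm {a b : X} (γ : Path.Homotopic.Quotient a b) :
    pathClass γ.symm = -pathClass γ := by
  rw [eq_neg_iff_add_eq_zero, ← pathClass_trans, Path.Homotopic.Quotient.symm_trans,
    pathClass_refl]

theorem simplexEdge_zero_source : simplexEdge 0 0 = simplexEdge 2 1 :=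
  stdSimplex.ext <| funext fun j => by
    rw [simplexEdge_zero, simplexEdge_two]; simp

theorem simplexEdge_one_source : simplexEdge 1 0 = simplexEdge 2 0 :=
  stdSimplex.ext <| funext fun j => by
    rw [simplexEdge_one, simplexEdge_two]; simp

theorem simplexEdge_one_target : simplexEdge 1 1 = simplexEdge 0 1 :=
  stdSimplex.ext <| funext fun j => by
    rw [simplexEdge_one, simplexEdge_zero]; simp

/-- Two edges of a singular triangle compose to the third up to homotopy. -/
theorem homotopic_edges (t : C(stdSimplex ℝ (Fin 3), X)) {a b c : X} (p : Path a b) (q : Path b c)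
    (r : Path a c) (h₂ : ∀ s, t (simplexEdge 2 s) = p s) (h₀ : ∀ s, t (simplexEdge 0 s) = q s)
    (h₁ : ∀ s, t (simplexEdge 1 s) = r s) : (p.trans q).Homotopic r := by
  -- The edge paths are already homotopic in the contractible simplex; `t` carries the homotopy
  -- over.
  have : ContractibleSpace (stdSimplex ℝ (Fin 3)) :=
    (convex_stdSimplex ℝ (Fin 3)).contractibleSpace ⟨_, single_mem_stdSimplex ℝ 0⟩
  let e₂ : Path (simplexEdge 2 0) (simplexEdge 2 1) := ⟨simplexEdge 2, rfl, rfl⟩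
  let e₀ : Path (simplexEdge 2 1) (simplexEdge 0 1) := ⟨simplexEdge 0, simplexEdge_zero_source, rfl⟩
  let e₁ : Path (simplexEdge 2 0) (simplexEdge 0 1) :=
    ⟨simplexEdge 1, simplexEdge_one_source, simplexEdge_one_target⟩
  obtain rfl : t (simplexEdge 2 0) = a := (h₂ 0).trans p.source
  obtain rfl : t (simplexEdge 2 1) = b := (h₂ 1).trans p.target
  obtain rfl : t (simplexEdge 0 1) = c := (h₀ 1).trans q.target
  have hp : p = e₂.map t.continuous := Path.ext (funext fun s => (h₂ s).symm)
  have hq : q = e₀.map t.continuous := Path.ext (funext fun s => (h₀ s).symm)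
  have hr : r = e₁.map t.continuous := Path.ext (funext fun s => (h₁ s).symm)
  rw [hp, hq, hr, ← Path.map_trans]
  exact (SimplyConnectedSpace.paths_homotopic (e₂.trans e₀) e₁).map t

/-- The curve parametrizing a singular `1`-simplex. -/
noncomputable def curveOfSingular (s : (TopCat.toSSet.obj (TopCat.of X)) _⦋1⦌) : C(I, X) :=
  (TopCat.toSSetObjEquiv (TopCat.of X) (.op ⦋1⦌) s).comp
    ⟨stdSimplexHomeomorphUnitInterval.symm, Homeomorph.continuous _⟩

theorem curveOfSingular_singularCurve (f : C(I, X)) : curveOfSingular (singularCurve f) = f := by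
  ext r
  simp [curveOfSingular, singularCurve]

variable {x₀ : X} (c : ∀ x : X, Path.Homotopic.Quotient x₀ x)

/-- The class in the abelianized fundamental group of a path, closed up by reference paths. -/
noncomputable def closedUpClass {a b : X} (γ : Path.Homotopic.Quotient a b) :
    Additive (Abelianization (FundamentalGroup X x₀)) :=
  .ofMul (Abelianization.of
    (((c a).trans γ).trans (c b).symm : Path.Homotopic.Quotient x₀ x₀))

theorem ofMul_abelianization_trans (γ δ : Path.Homotopic.Quotient x₀ x₀) :
    Additive.ofMul (Abelianization.of (G := FundamentalGroup X x₀) (γ.trans δ)) =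
      Additive.ofMul (Abelianization.of (G := FundamentalGroup X x₀) γ) +
        Additive.ofMul (Abelianization.of (G := FundamentalGroup X x₀) δ) := by
  -- `γ.trans δ` is the product `δ * γ` in `FundamentalGroup`, hence the swap.
  rw [add_comm, ← ofMul_mul, ← map_mul]
  rfl

/-- The reference path to `b` cancels against its inverse. -/
theorem closedUpClass_trans {a b d : X} (γ : Path.Homotopic.Quotient a b)
    (δ : Path.Homotopic.Quotient b d) :
    closedUpClass c (γ.trans δ) = closedUpClass c γ + closedUpClass c δ := by
  rw [closedUpClass, closedUpClass, closedUpClass, ← ofMul_abelianization_trans]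
  congr 2
  rw [Path.Homotopic.Quotient.trans_assoc, Path.Homotopic.Quotient.trans_assoc,
    Path.Homotopic.Quotient.trans_assoc, Path.Homotopic.Quotient.trans_assoc,
    Path.Homotopic.Quotient.trans_assoc, ← Path.Homotopic.Quotient.trans_assoc (c b).symm,
    Path.Homotopic.Quotient.symm_trans, Path.Homotopic.Quotient.refl_trans]

/-- Closing up a loop at `x₀` conjugates it by `c x₀`, which the abelianization does not see. -/
theorem closedUpClass_loop (γ : Path.Homotopic.Quotient x₀ x₀) :
    closedUpClass c γ = .ofMul (Abelianization.of (G := FundamentalGroup X x₀) γ) := by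
  rw [closedUpClass, ofMul_abelianization_trans, ofMul_abelianization_trans, add_right_comm,
    ← ofMul_abelianization_trans, Path.Homotopic.Quotient.trans_symm]
  exact zero_add _

/-- The value of the Hurewicz cocycle on a singular `1`-simplex. -/
noncomputable def hurewiczCocycle (s : (TopCat.toSSet.obj (TopCat.of X)) _⦋1⦌) :
    AddCommGrpCat.of (Additive (Abelianization (FundamentalGroup X x₀))) :=
  closedUpClass c (.mk ⟨curveOfSingular s, rfl, rfl⟩)

theorem hurewiczCocycle_singularCurve {a b : X} (p : Path a b) :
    hurewiczCocycle c (singularCurve (p : C(I, X))) = closedUpClass c (.mk p) := by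
  obtain ⟨p, rfl, rfl⟩ := p
  -- The endpoints in the type depend on the curve, so it is made a variable before substitution.
  have : ∀ f : C(I, X), f = p →
      closedUpClass c (.mk ⟨f, rfl, rfl⟩) = closedUpClass c (.mk ⟨p, rfl, rfl⟩) := by
    rintro f rfl
    rfl
  exact this _ (curveOfSingular_singularCurve p)

theorem hurewiczCocycle_add (t : (TopCat.toSSet.obj (TopCat.of X)) _⦋2⦌) :
    hurewiczCocycle c ((TopCat.toSSet.obj (TopCat.of X)).δ 2 t) +
      hurewiczCocycle c ((TopCat.toSSet.obj (TopCat.of X)).δ 0 t) =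
    hurewiczCocycle c ((TopCat.toSSet.obj (TopCat.of X)).δ 1 t) := by
  obtain ⟨t, rfl⟩ := singularTriangle_surjective t
  let p : Path (t (simplexEdge 2 0)) (t (simplexEdge 2 1)) := ⟨t.comp (simplexEdge 2), rfl, rfl⟩
  let q : Path (t (simplexEdge 2 1)) (t (simplexEdge 0 1)) :=
    ⟨t.comp (simplexEdge 0), congrArg t simplexEdge_zero_source, rfl⟩
  let r : Path (t (simplexEdge 2 0)) (t (simplexEdge 0 1)) :=
    ⟨t.comp (simplexEdge 1), congrArg t simplexEdge_one_source, congrArg t simplexEdge_one_target⟩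
  rw [δ_singularTriangle, δ_singularTriangle, δ_singularTriangle]
  have h := homotopic_edges t p q r (fun _ => rfl) (fun _ => rfl) (fun _ => rfl)
  have h2 := hurewiczCocycle_singularCurve c p
  have h0 := hurewiczCocycle_singularCurve c q
  have h1 := hurewiczCocycle_singularCurve c r
  refine (congrArg₂ (· + ·) h2 h0).trans (Eq.trans ?_ h1.symm)
  rw [← closedUpClass_trans, ← Path.Homotopic.Quotient.mk_trans, Path.Homotopic.Quotient.eq.2 h]

/-- The homomorphism from the abelianized fundamental group to one-chains modulo boundaries. -/
noncomputable def hurewiczHom (x₀ : X) :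
    AddCommGrpCat.of (Additive (Abelianization (FundamentalGroup X x₀))) ⟶
      OneChainClasses (TopCat.toSSet.obj (TopCat.of X)) :=
  AddCommGrpCat.ofHom <| MonoidHom.toAdditiveLeft <| Abelianization.lift
    { toFun γ := Multiplicative.ofAdd (pathClass (X := X) (a := x₀) (b := x₀) γ)
      map_one' := congrArg Multiplicative.ofAdd (pathClass_refl x₀)
      map_mul' γ δ := congrArg Multiplicative.ofAdd
        ((pathClass_trans (X := X) (a := x₀) (b := x₀) (c := x₀) δ γ).trans (add_comm _ _)) }

/-- The first homology group of a path connected space is the abelianized fundamental group. -/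
theorem nonempty_abelianization_addEquiv_firstHomology [PathConnectedSpace X] (x₀ : X) :
    Nonempty (Additive (Abelianization (FundamentalGroup X x₀)) ≃+ firstHomology X) := by
  let c : ∀ x : X, Path.Homotopic.Quotient x₀ x := fun x =>
    .mk (PathConnectedSpace.somePath x₀ x)
  have hsurj : ∀ a : Additive (Abelianization (FundamentalGroup X x₀)), ∃ p : Path x₀ x₀,
      a = .ofMul (Abelianization.of (G := FundamentalGroup X x₀) (.mk p)) := by
    intro a
    obtain ⟨γ, hγ⟩ := QuotientGroup.mk_surjective a.toMul
    obtain ⟨p, rfl⟩ := Quotient.exists_rep γ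
    exact ⟨p, congrArg Additive.ofMul hγ.symm⟩
  -- The contraction sends a point to the class of its reference path: a closed-up edge s from a to
  -- b then has class c(a) + [s] − c(b).
  refine nonempty_addEquiv_homology_one (hurewiczCocycle c) (hurewiczCocycle_add c)
    (hurewiczHom x₀) (fun a => ?_) (fun a => ?_)
    (fun x => pathClass (c (TopCat.toSSetObj₀Equiv x))) (fun s => ?_)
  · obtain ⟨p, rfl⟩ := hsurj a
    change edgeBoundary _ (edgeClass (singularCurve (p : C(I, X)))) = 0
    rw [edgeBoundary_edgeClass, δ_one_singularCurve, δ_zero_singularCurve]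
    simp
  · obtain ⟨p, rfl⟩ := hsurj a
    change edgeClassDesc _ _ (edgeClass (singularCurve (p : C(I, X)))) = _
    rw [edgeClassDesc_edgeClass, hurewiczCocycle_singularCurve, closedUpClass_loop]
  · obtain ⟨f, rfl⟩ := singularCurve_surjective s
    let p : Path (f 0) (f 1) := ⟨f, rfl, rfl⟩
    have h : hurewiczCocycle c (singularCurve f) = closedUpClass c (.mk p) :=
      hurewiczCocycle_singularCurve c p
    rw [h]
    change pathClass (((c _).trans (.mk p)).trans (c _).symm) = _
    rw [pathClass_trans, pathClass_trans, pathClass_symm,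
      δ_one_singularCurve, δ_zero_singularCurve, singularPoint, singularPoint,
      Equiv.apply_symm_apply, Equiv.apply_symm_apply, sub_eq_add_neg]
    rfl

end Hurewicz

/-! ### Local topology of manifolds -/

section LocalTopology

open Topology Set

/-- Every point has a neighbourhood in which paths with the same endpoints are homotopic in the
whole space. -/
def SemilocallySimplyConnected (X : Type*) [TopologicalSpace X] : Prop :=
  ∀ x : X, ∃ W ∈ 𝓝 x, ∀ (a b : X) (p q : Path a b), (∀ t, p t ∈ W) → (∀ t, q t ∈ W) →
    p.Homotopic q

/-- The local homeomorphisms serve as charts of `X` modelled on `Y`. -/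
theorem IsLocalHomeomorph.locallyPathConnectedSpace {X Y : Type*} [TopologicalSpace X]
    [TopologicalSpace Y] [LocallyPathConnectedSpace Y] {f : X → Y} (hf : IsLocalHomeomorph f) :
    LocallyPathConnectedSpace X := by
  choose e he _ using hf
  let _ : ChartedSpace Y X :=
    { atlas := range e
      chartAt := e
      mem_chart_source := he
      chart_mem_atlas := fun x => ⟨x, rfl⟩ }
  exact ChartedSpace.locallyPathConnectedSpace Y X

variable {E : Type*} [NormedAddCommGroup E] [NormedSpace ℝ E] {B : Type*} [TopologicalSpace B]

theorem ModelWithCorners.locallyPathConnectedSpace_manifold (J : ModelWithCorners ℝ E B)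
    (M : Type*) [TopologicalSpace M] [ChartedSpace B M] : LocallyPathConnectedSpace M := by
  have := J.convex_range.locallyPathConnectedSpace
  have : LocallyPathConnectedSpace B :=
    J.isClosedEmbedding.isEmbedding.toHomeomorph.symm.isQuotientMap.locallyPathConnectedSpace
  exact ChartedSpace.locallyPathConnectedSpace B M

/-- A small ball meets the convex set `range J` in a convex subset of the chart's target, so the
straight-line homotopy pulls back to `M`. Only convexity is needed, so boundary points require no
separate treatment. -/
theorem ModelWithCorners.semilocallySimplyConnected (J : ModelWithCorners ℝ E B)
    (M : Type*) [TopologicalSpace M] [ChartedSpace B M] : SemilocallySimplyConnected M := by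
  intro x
  obtain ⟨r, hr, hball⟩ := Metric.mem_nhdsWithin_iff.1 (extChartAt_target_mem_nhdsWithin (I := J) x)
  let φ := extChartAt J x
  refine ⟨φ.source ∩ φ ⁻¹' Metric.ball (φ x) r, Filter.inter_mem (extChartAt_source_mem_nhds x)
    ((continuousAt_extChartAt x).preimage_mem_nhds (Metric.ball_mem_nhds _ hr)), ?_⟩
  intro a b p q hp hq
  have hconv : Convex ℝ (Metric.ball (φ x) r ∩ range J) := (convex_ball _ _).inter J.convex_range
  have hmem : ∀ y ∈ φ.source ∩ φ ⁻¹' Metric.ball (φ x) r, φ y ∈ Metric.ball (φ x) r ∩ range J :=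
    fun y hy => ⟨hy.2, extChartAt_target_subset_range x (φ.map_source hy.1)⟩
  have hcont : ∀ p : Path a b, (∀ t, p t ∈ φ.source ∩ φ ⁻¹' Metric.ball (φ x) r) →
      Continuous fun t => φ (p t) := fun p hp =>
    (continuousOn_extChartAt x).comp_continuous p.continuous fun t => (hp t).1
  have hpc := hcont p hp
  have hqc := hcont q hq
  have hline : ∀ z : unitInterval × unitInterval,
      AffineMap.lineMap (φ (p z.2)) (φ (q z.2)) (z.1 : ℝ) ∈ φ.target :=
    fun z => hball (hconv.lineMap_mem (hmem _ (hp _)) (hmem _ (hq _)) z.1.2)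
  have hinv : ∀ p : Path a b, (∀ t, p t ∈ φ.source ∩ φ ⁻¹' Metric.ball (φ x) r) →
      ∀ t, φ.symm (φ (p t)) = p t := fun p hp t => φ.left_inv (hp t).1
  refine ⟨⟨⟨⟨fun z =>
    φ.symm (AffineMap.lineMap (φ (p z.2)) (φ (q z.2)) (z.1 : ℝ)), ?_⟩, ?_, ?_⟩, ?_⟩⟩
  · refine (continuousOn_extChartAt_symm x).comp_continuous ?_ hline
    simp only [AffineMap.lineMap_apply_module]
    have hs : Continuous fun z : unitInterval × unitInterval => (z.1 : ℝ) :=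
      continuous_subtype_val.comp continuous_fst
    exact ((continuous_const.sub hs).smul (hpc.comp continuous_snd)).add
      (hs.smul (hqc.comp continuous_snd))
  · intro t
    simp [hinv p hp]
  · intro t
    simp [hinv q hq]
  · rintro s t (rfl | rfl)
    · have h := hinv p hp 0
      rw [p.source] at h
      simpa using h
    · have h := hinv p hp 1
      rw [p.target] at h
      simpa using h

end LocalTopology

/-! ### The covering attached to an action of the fundamental group -/

section CoveringOfAction

open Topology Set unitInterval
open Path.Homotopic (Quotient)

theorem Path.Homotopic.Quotient.trans_trans_symm {X : Type*} [TopologicalSpace X] {a b d e : X}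
    (γ : Quotient a b) (δ : Quotient e b) (η : Quotient b d) :
    (γ.trans η).trans (δ.trans η).symm = γ.trans δ.symm := by
  induction γ using Quotient.ind with | _ p
  induction δ using Quotient.ind with | _ q
  induction η using Quotient.ind with | _ r
  have : (Quotient.trans (.mk q) (.mk r)).symm =
      Quotient.trans (.symm (.mk r)) (.symm (.mk q)) := by
    rw [← Quotient.mk_trans, ← Quotient.mk_symm, Path.trans_symm]
    rfl
  rw [this, Quotient.trans_assoc, ← Quotient.trans_assoc (.mk r), Quotient.trans_symm,
    Quotient.refl_trans]

theorem Path.Homotopic.Quotient.trans_symm_trans {X : Type*} [TopologicalSpace X] {a b d e : X}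
    (γ : Quotient a b) (δ : Quotient d b) (η : Quotient b e) :
    (γ.trans δ.symm).trans (δ.trans η) = γ.trans η := by
  rw [Quotient.trans_assoc, ← Quotient.trans_assoc δ.symm, Quotient.symm_trans,
    Quotient.refl_trans]

variable {M : Type u} [TopologicalSpace M]

/-- Take the path component of `x` in the interior of the given neighbourhood; it is open by local
path connectedness. -/
theorem SemilocallySimplyConnected.exists_isOpen [LocallyPathConnectedSpace M]
    (hM : SemilocallySimplyConnected M) (x : M) :
    ∃ U : Set M, IsOpen U ∧ x ∈ U ∧ IsPathConnected U ∧
      ∀ (a b : M) (p q : Path a b), (∀ t, p t ∈ U) → (∀ t, q t ∈ U) → p.Homotopic q := by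
  obtain ⟨W, hW, h⟩ := hM x
  refine ⟨pathComponentIn (interior W) x, isOpen_interior.pathComponentIn x,
    mem_pathComponentIn_self (mem_interior_iff_mem_nhds.2 hW),
    isPathConnected_pathComponentIn (mem_interior_iff_mem_nhds.2 hW), ?_⟩
  intro a b p q hp hq
  exact h a b p q (fun t => interior_subset (pathComponentIn_subset (hp t)))
    fun t => interior_subset (pathComponentIn_subset (hq t))

variable [LocallyPathConnectedSpace M] (hM : SemilocallySimplyConnected M)

/-- A path connected open neighbourhood in which paths are determined up to homotopy by their
endpoints. -/
def smallNhd (x : M) : Set M := (hM.exists_isOpen x).choose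

theorem isOpen_smallNhd (x : M) : IsOpen (smallNhd hM x) := (hM.exists_isOpen x).choose_spec.1

theorem mem_smallNhd (x : M) : x ∈ smallNhd hM x := (hM.exists_isOpen x).choose_spec.2.1

theorem isPathConnected_smallNhd (x : M) : IsPathConnected (smallNhd hM x) :=
  (hM.exists_isOpen x).choose_spec.2.2.1

theorem homotopic_of_mem_smallNhd (x : M) {a b : M} (p q : Path a b)
    (hp : ∀ t, p t ∈ smallNhd hM x) (hq : ∀ t, q t ∈ smallNhd hM x) : p.Homotopic q :=
  (hM.exists_isOpen x).choose_spec.2.2.2 a b p q hp hq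

variable {x₀ : M} (c : ∀ x : M, Quotient x₀ x)

open Classical in
/-- Transport from the base point to `x` through the small neighbourhood of `i`. -/
noncomputable def localTransport (i x : M) : Quotient x₀ x :=
  if h : x ∈ smallNhd hM i then
    (c i).trans (.mk ((isPathConnected_smallNhd hM i).joinedIn i (mem_smallNhd hM i) x h).somePath)
  -- A default value; the cocycle identities for `transportLoop` hold whatever it is.
  else c x

theorem localTransport_eq {i x : M} (p : Path i x) (hp : ∀ t, p t ∈ smallNhd hM i) :
    localTransport hM c i x = (c i).trans (.mk p) := by
  have hx : x ∈ smallNhd hM i := p.target ▸ hp 1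
  rw [localTransport, dif_pos hx]
  congr 1
  exact Quotient.eq.2 (homotopic_of_mem_smallNhd hM i _ _ (JoinedIn.somePath_mem _) hp)

theorem localTransport_self (i : M) : localTransport hM c i i = c i := by
  rw [localTransport_eq hM c (Path.refl i) fun _ => mem_smallNhd hM i, Quotient.mk_refl,
    Quotient.trans_refl]

theorem localTransport_trans (i : M) {x y : M} (p : Path x y) (hp : ∀ t, p t ∈ smallNhd hM i) :
    localTransport hM c i y = (localTransport hM c i x).trans (.mk p) := by
  have hx : x ∈ smallNhd hM i := p.source ▸ hp 0
  let J := (isPathConnected_smallNhd hM i).joinedIn i (mem_smallNhd hM i) x hx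
  rw [localTransport_eq hM c J.somePath J.somePath_mem,
    localTransport_eq hM c (J.somePath.trans p), Quotient.trans_assoc, Quotient.mk_trans]
  intro t
  have : J.somePath.trans p t ∈ range (J.somePath.trans p) := ⟨t, rfl⟩
  rw [Path.trans_range] at this
  rcases this with ⟨s, hs⟩ | ⟨s, hs⟩
  · rw [← hs]; exact J.somePath_mem s
  · rw [← hs]; exact hp s

variable (F : Type u) [TopologicalSpace F] [DiscreteTopology F]
  [MulAction (FundamentalGroup M x₀) F]

/-- The loop comparing the transports to `x` through the neighbourhoods of `i` and `j`. -/
noncomputable def transportLoop (i j x : M) : FundamentalGroup M x₀ :=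
  (localTransport hM c i x).trans (localTransport hM c j x).symm

/-- Moving `x` to `y` inside both neighbourhoods appends the same path to both transports, and it
cancels. Local constancy makes the transition functions continuous. -/
theorem transportLoop_eventuallyEq {i j x : M} (hi : x ∈ smallNhd hM i) (hj : x ∈ smallNhd hM j) :
    ∀ᶠ y in 𝓝 x, transportLoop hM c i j y = transportLoop hM c i j x := by
  have hU : smallNhd hM i ∩ smallNhd hM j ∈ 𝓝 x :=
    ((isOpen_smallNhd hM i).inter (isOpen_smallNhd hM j)).mem_nhds ⟨hi, hj⟩
  filter_upwards [pathComponentIn_mem_nhds hU] with y hy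
  let p := JoinedIn.somePath hy
  have hp : ∀ t, p t ∈ smallNhd hM i ∩ smallNhd hM j := JoinedIn.somePath_mem hy
  rw [transportLoop, localTransport_trans hM c i p fun t => (hp t).1,
    localTransport_trans hM c j p fun t => (hp t).2]
  exact Quotient.trans_trans_symm _ _ _

/-- The gluing data of the covering attached to an action of the fundamental group. -/
noncomputable def actionBundleCore : FiberBundleCore M M F where
  baseSet := smallNhd hM
  isOpen_baseSet := isOpen_smallNhd hM
  indexAt := id
  mem_baseSet_at := mem_smallNhd hM
  coordChange i j x v := transportLoop hM c i j x • v
  coordChange_self i x _ v := by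
    have : transportLoop hM c i i x = 1 := Quotient.trans_symm _
    rw [this, one_smul]
  continuousOn_coordChange i j := by
    rintro ⟨x, v⟩ ⟨⟨hi, hj⟩, -⟩
    refine ContinuousAt.continuousWithinAt ?_
    have : (fun p : M × F => transportLoop hM c i j p.1 • p.2) =ᶠ[𝓝 (x, v)]
        fun p => transportLoop hM c i j x • p.2 := by
      filter_upwards [continuousAt_fst.eventually (transportLoop_eventuallyEq hM c hi hj)] with p hp
      rw [hp]
    refine ContinuousAt.congr ?_ this.symm
    exact (continuous_of_discreteTopology.comp continuous_snd).continuousAt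
  coordChange_comp i j k x _ v := by
    rw [← mul_smul]
    congr 1
    -- Products are concatenations in reverse order, which matches the composition of transition
    -- functions.
    exact Quotient.trans_symm_trans _ _ _

/-- The total space of the covering attached to an action of the fundamental group. -/
noncomputable abbrev ActionTotal : Type u := (actionBundleCore hM c F).TotalSpace

/-- The projection of the covering attached to an action of the fundamental group. -/
noncomputable abbrev actionProj : ActionTotal hM c F → M := (actionBundleCore hM c F).proj

theorem isCoveringMap_actionProj : IsCoveringMap (actionProj hM c F) :=
  FiberBundle.isCoveringMap (F := F) (E := (actionBundleCore hM c F).Fiber)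

/-- The loop obtained by closing up a path with reference paths. -/
noncomputable def closedUpLoop {x y : M} (γ : Quotient x y) : FundamentalGroup M x₀ :=
  ((c x).trans γ).trans (c y).symm

variable {F}

/-- The monodromy of the covering attached to an action. -/
theorem monodromy_actionProj {x y : M} (p : Path x y) (v : F) :
    (isCoveringMap_actionProj hM c F).monodromy (.mk p) ⟨⟨x, v⟩, rfl⟩ =
      ⟨⟨y, closedUpLoop c (.mk p) • v⟩, rfl⟩ := by
  obtain ⟨p, rfl, rfl⟩ := p
  let p' : Path (p 0) (p 1) := ⟨p, rfl, rfl⟩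
  -- The candidate lift acts on `v` at time t by the closed-up initial segment of the path. Near t₀,
  -- in the chart at p(t₀), its fibre coordinate is constant, so it is continuous.
  let loop : I → FundamentalGroup M x₀ := fun t =>
    ((c (p 0)).trans (.mk (p'.subpath 0 t))).trans (c (p t)).symm
  let Γ : I → ActionTotal hM c F := fun t => ⟨p t, loop t • v⟩
  have hΓ : Continuous Γ := by
    rw [continuous_iff_continuousAt]
    intro t₀
    refine ((actionBundleCore hM c F).localTriv (p t₀)).continuousAt_of_comp_left
      p.continuous.continuousAt (mem_smallNhd hM (p t₀)) ?_
    have hev : ∀ᶠ t in 𝓝 t₀, (actionBundleCore hM c F).localTriv (p t₀) (Γ t) =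
        (p t, loop t₀ • v) := by
      have hpre : p ⁻¹' smallNhd hM (p t₀) ∈ 𝓝 t₀ :=
        p.continuous.continuousAt.preimage_mem_nhds
          ((isOpen_smallNhd hM _).mem_nhds (mem_smallNhd hM _))
      -- For such t the whole segment of the path between times t₀ and t stays in the small
      -- neighbourhood.
      filter_upwards [ordConnectedComponent_mem_nhds.2 hpre] with t ht
      have hsub : ∀ s, p'.subpath t₀ t s ∈ smallNhd hM (p t₀) := by
        intro s
        have : p'.subpath t₀ t s ∈ range (p'.subpath t₀ t) := ⟨s, rfl⟩
        rw [Path.range_subpath] at this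
        obtain ⟨r, hr, hrs⟩ := this
        rw [← hrs]
        exact ht hr
      change (p t, transportLoop hM c (p t) (p t₀) (p t) • loop t • v) = _
      rw [← mul_smul]
      congr 2
      change ((((c (p 0)).trans (.mk (p'.subpath 0 t))).trans (c (p t)).symm).trans
        ((localTransport hM c (p t) (p t)).trans (localTransport hM c (p t₀) (p t)).symm) :
        Quotient x₀ x₀) = ((c (p 0)).trans (.mk (p'.subpath 0 t₀))).trans (c (p t₀)).symm
      have hT : localTransport hM c (p t₀) (p t) =
          (c (p t₀)).trans (.mk (p'.subpath t₀ t) : Quotient (p t₀) (p t)) :=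
        localTransport_eq hM c (p'.subpath t₀ t) hsub
      have hS : (.mk (p'.subpath 0 t) : Quotient (p 0) (p t)) =
          (.mk (p'.subpath 0 t₀) : Quotient (p 0) (p t₀)).trans (.mk (p'.subpath t₀ t)) :=
        (Path.Homotopic.Quotient.eq.2
          ⟨Path.Homotopy.subpathTransSubpath p' 0 t₀ t⟩).symm
      rw [localTransport_self, Quotient.trans_symm_trans, hT, hS, ← Quotient.trans_assoc]
      exact Quotient.trans_trans_symm _ _ _
    exact ContinuousAt.congr (p.continuous.continuousAt.prodMk continuousAt_const)
      (hev.mono fun t ht => ht.symm)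
  have h0 : Γ 0 = ⟨p 0, v⟩ := by
    have : loop 0 = 1 := by
      change ((c (p 0)).trans (.mk (p'.subpath 0 0))).trans (c (p 0)).symm = Quotient.refl x₀
      rw [Path.subpath_self]
      change ((c (p 0)).trans (.refl (p 0))).trans (c (p 0)).symm = _
      rw [Quotient.trans_refl, Quotient.trans_symm]
    change (⟨p 0, loop 0 • v⟩ : ActionTotal hM c F) = _
    rw [this, one_smul]
  have h1 : Γ 1 = ⟨p 1, closedUpLoop c (.mk p') • v⟩ := by
    have : p'.subpath 0 1 = p' := p'.subpath_zero_one
    change (⟨p 1, loop 1 • v⟩ : ActionTotal hM c F) = _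
    simp only [loop, this]
    rfl
  refine Subtype.ext ?_
  have := ((isCoveringMap_actionProj hM c F).eq_liftPath_iff (γ := p) (e := ⟨p 0, v⟩) rfl
    (Γ := Γ)).2 ⟨hΓ, rfl, h0⟩
  refine (congrFun this 1).symm.trans h1

omit [LocallyPathConnectedSpace M] in
theorem IsCoveringMap.joined_monodromy {X : Type*} [TopologicalSpace X] {f : X → M}
    (cov : IsCoveringMap f) {x y : M} (γ : Quotient x y) (e : f ⁻¹' {x}) :
    Joined e.1 (cov.monodromy γ e).1 :=
  ⟨(cov.liftPathQuotient γ e).out⟩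

omit [LocallyPathConnectedSpace M] in
-- With `c x₀` trivial, closing up a loop at `x₀` does nothing, so the monodromy at `x₀` is exactly
-- the given action.
theorem exists_referencePaths [PathConnectedSpace M] (x₀ : M) :
    ∃ c : ∀ x : M, Quotient x₀ x, c x₀ = .refl x₀ :=
  ⟨fun x => (Path.Homotopic.Quotient.mk (PathConnectedSpace.somePath x₀ x₀)).symm.trans
    (.mk (PathConnectedSpace.somePath x₀ x)), Quotient.symm_trans _⟩

theorem monodromy_actionProj_base (hc : c x₀ = .refl x₀) (γ : FundamentalGroup M x₀) (v : F) :
    (isCoveringMap_actionProj hM c F).monodromy (x := x₀) (y := x₀) γ ⟨⟨x₀, v⟩, rfl⟩ =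
      ⟨⟨x₀, γ • v⟩, rfl⟩ := by
  obtain ⟨p, rfl⟩ := Path.Homotopic.Quotient.mk_surjective (x₀ := x₀) (x₁ := x₀) γ
  rw [monodromy_actionProj]
  have : closedUpLoop c (.mk p) = Path.Homotopic.Quotient.mk p := by
    rw [closedUpLoop, hc, Quotient.refl_trans]
    exact Quotient.trans_refl (.mk p)
  rw [this]

theorem monodromy_actionProj_reference (hc : c x₀ = .refl x₀) (y : M) (v : F) :
    (isCoveringMap_actionProj hM c F).monodromy (c y) ⟨⟨x₀, v⟩, rfl⟩ = ⟨⟨y, v⟩, rfl⟩ := by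
  obtain ⟨p, hp⟩ := Path.Homotopic.Quotient.mk_surjective (c y)
  rw [← hp, monodromy_actionProj]
  have : closedUpLoop c (.mk p) = 1 := by
    rw [closedUpLoop, hc, Quotient.refl_trans, hp]
    exact Quotient.trans_symm (c y)
  rw [this, one_smul]

/-- By transitivity, loops connect all points over `x₀`; reference paths then lead to every other
fibre. -/
theorem pathConnectedSpace_actionTotal (hc : c x₀ = .refl x₀) [Nonempty F]
    [MulAction.IsPretransitive (FundamentalGroup M x₀) F] :
    PathConnectedSpace (ActionTotal hM c F) := by
  obtain ⟨v₀⟩ := ‹Nonempty F›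
  have key : ∀ e : ActionTotal hM c F, Joined (⟨x₀, v₀⟩ : ActionTotal hM c F) e := by
    rintro ⟨y, v⟩
    obtain ⟨γ, rfl⟩ := MulAction.exists_smul_eq (FundamentalGroup M x₀) v₀ v
    have h₁ := (isCoveringMap_actionProj hM c F).joined_monodromy (x := x₀) (y := x₀) γ
      ⟨⟨x₀, v₀⟩, rfl⟩
    have h₂ := (isCoveringMap_actionProj hM c F).joined_monodromy (c y) ⟨⟨x₀, γ • v₀⟩, rfl⟩
    rw [monodromy_actionProj_base hM c hc] at h₁
    rw [monodromy_actionProj_reference hM c hc] at h₂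
    exact h₁.trans h₂
  exact ⟨⟨⟨x₀, v₀⟩⟩, fun a b => (key a).symm.trans (key b)⟩

include hM in
/-- Every subgroup of finite index is the stabilizer of a point in the fibre of a covering. -/
theorem exists_nFoldCovering [PathConnectedSpace M] (x₀ : M) {n : ℕ} (hn : n ≠ 0)
    (K : Subgroup (FundamentalGroup M x₀)) (hK : K.index = n) :
    ∃ (X : NFoldCovering M n) (e : X.proj ⁻¹' {x₀}),
      ∀ γ : FundamentalGroup M x₀,
        X.isCoveringMap.monodromy (x := x₀) (y := x₀) γ e = e ↔ γ ∈ K := by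
  obtain ⟨c, hc⟩ := exists_referencePaths x₀
  -- The action on cosets is transitive, and the trivial coset has stabilizer `K`.
  let Q := FundamentalGroup M x₀ ⧸ K
  let _ : TopologicalSpace Q := ⊥
  have : DiscreteTopology Q := ⟨rfl⟩
  have := pathConnectedSpace_actionTotal hM c (F := Q) hc
  refine ⟨⟨ActionTotal hM c Q, actionProj hM c Q, isCoveringMap_actionProj hM c Q, fun x => ?_⟩,
    ⟨⟨x₀, ((1 : FundamentalGroup M x₀) : Q)⟩, rfl⟩, fun γ => ?_⟩
  · have hinj : Function.Injective fun v : Q => (⟨x, v⟩ : ActionTotal hM c Q) := by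
      intro v w h
      exact eq_of_heq (Bundle.TotalSpace.mk.inj h).2
    have : actionProj hM c Q ⁻¹' {x} = range fun v : Q => (⟨x, v⟩ : ActionTotal hM c Q) := by
      ext ⟨y, v⟩
      constructor
      · rintro rfl
        exact ⟨v, rfl⟩
      · rintro ⟨w, hw⟩
        exact (congrArg (actionProj hM c Q) hw).symm
    rw [this, ← image_univ, hinj.encard_image, encard_univ]
    have hc : Nat.card Q = n := hK
    have : Finite Q := Nat.finite_of_card_ne_zero (hc ▸ hn)
    rw [← hc, ENat.card_eq_coe_natCard]
  · change (isCoveringMap_actionProj hM c Q).monodromy (x := x₀) (y := x₀) γ _ = _ ↔ _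
    rw [monodromy_actionProj_base hM c hc]
    have hs : γ • ((1 : FundamentalGroup M x₀) : Q) = ((γ : FundamentalGroup M x₀) : Q) := by
      rw [MulAction.Quotient.smul_coe, smul_eq_mul, mul_one]
    have hi : ((⟨⟨x₀, γ • ((1 : FundamentalGroup M x₀) : Q)⟩, rfl⟩ :
        actionProj hM c Q ⁻¹' {x₀}) = ⟨⟨x₀, ((1 : FundamentalGroup M x₀) : Q)⟩, rfl⟩) ↔
        γ • ((1 : FundamentalGroup M x₀) : Q) = ((1 : FundamentalGroup M x₀) : Q) := by
      constructor
      · intro h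
        exact eq_of_heq (Bundle.TotalSpace.mk.inj (congrArg Subtype.val h)).2
      · intro h
        rw [h]
    rw [hi, hs, eq_comm, QuotientGroup.eq, inv_one, one_mul]

end CoveringOfAction

/-! ### Fibre stabilizers, fundamental groups and lifting -/

section FibreStabilizer

variable {M : Type*} [TopologicalSpace M] {X : Type*} [TopologicalSpace X] {f : X → M}
  {Y : Type*} [TopologicalSpace Y] {g : Y → M} {x : M}

/-- The stabilizer of a point of the fibre under the monodromy action. -/
noncomputable def IsCoveringMap.fibreStabilizer (cov : IsCoveringMap f) (e : f ⁻¹' {x}) :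
    Subgroup (FundamentalGroup M x) :=
  letI := cov.fundamentalGroupMulAction x
  MulAction.stabilizer (FundamentalGroup M x) e

namespace IsCoveringMap

theorem mem_fibreStabilizer (cov : IsCoveringMap f) {e : f ⁻¹' {x}} {γ : FundamentalGroup M x} :
    γ ∈ cov.fibreStabilizer e ↔ cov.monodromy (x := x) (y := x) γ e = e :=
  Iff.rfl

theorem fibreStabilizer_monodromy (cov : IsCoveringMap f) (e : f ⁻¹' {x})
    (γ : FundamentalGroup M x) :
    cov.fibreStabilizer (cov.monodromy (x := x) (y := x) γ e) =
      (cov.fibreStabilizer e).map (MulAut.conj γ).toMonoidHom :=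
  let _ := cov.fundamentalGroupMulAction x
  MulAction.stabilizer_smul_eq_stabilizer_map_conj γ e

/-- Project a path from `e` to `e'` to the base. -/
theorem exists_monodromy_eq [PathConnectedSpace X] (cov : IsCoveringMap f) (e e' : f ⁻¹' {x}) :
    ∃ γ : FundamentalGroup M x, cov.monodromy (x := x) (y := x) γ e = e' := by
  let Γ : Path.Homotopic.Quotient e.1 e'.1 := .mk (PathConnectedSpace.somePath e.1 e'.1)
  refine ⟨((Γ.map ⟨f, cov.continuous⟩).cast (x' := x) (y' := x) e.2.symm e'.2.symm :),
    cov.monodromy_eq_of_map_eq Γ ?_⟩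
  exact ((Path.Homotopic.Quotient.cast_cast _ _ _ _ _).trans
    (Path.Homotopic.Quotient.cast_rfl_rfl _)).symm

theorem index_fibreStabilizer [PathConnectedSpace X] (cov : IsCoveringMap f) (e : f ⁻¹' {x}) :
    (cov.fibreStabilizer e).index = Nat.card (f ⁻¹' {x}) := by
  let _ := cov.fundamentalGroupMulAction x
  have : MulAction.IsPretransitive (FundamentalGroup M x) (f ⁻¹' {x}) :=
    ⟨cov.exists_monodromy_eq⟩
  exact MulAction.index_stabilizer_of_transitive _ e

/-- A loop fixes `e` exactly when its lift from `e` closes up, that is, when it is the image of a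
loop. -/
theorem range_mapOfEq (cov : IsCoveringMap f) (e : X) (he : f e = x) :
    (FundamentalGroup.mapOfEq ⟨f, cov.continuous⟩ he).range =
      cov.fibreStabilizer (⟨e, he⟩ : f ⁻¹' {x}) := by
  subst he
  ext γ
  rw [mem_fibreStabilizer]
  constructor
  · rintro ⟨δ, rfl⟩
    rw [FundamentalGroup.mapOfEq_apply, Path.Homotopic.Quotient.cast_rfl_rfl]
    exact cov.monodromy_map (x := e) (y := e) δ
  · intro h
    let δ := cov.liftPathQuotient (x := f e) (y := f e) γ ⟨e, rfl⟩
    refine ⟨(δ.cast rfl (congrArg Subtype.val h).symm :), ?_⟩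
    rw [FundamentalGroup.mapOfEq_apply, Path.Homotopic.Quotient.map_cast, map_liftPathQuotient]
    simp only [Path.Homotopic.Quotient.cast_cast]
    exact (Path.Homotopic.Quotient.cast_cast (x := f e) (y := f e) γ _ _ _ _).trans
      (Path.Homotopic.Quotient.cast_rfl_rfl _)

theorem mapOfEq_injective (cov : IsCoveringMap f) (e : X) (he : f e = x) :
    Function.Injective (FundamentalGroup.mapOfEq ⟨f, cov.continuous⟩ he) := by
  subst he
  intro γ δ h
  rw [FundamentalGroup.mapOfEq_apply, FundamentalGroup.mapOfEq_apply,
    Path.Homotopic.Quotient.cast_rfl_rfl, Path.Homotopic.Quotient.cast_rfl_rfl] at h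
  exact cov.injective_path_homotopic_map e e h

/-- The stabilizer of a point of the fibre is the fundamental group of the total space. -/
noncomputable def fundamentalGroupEquiv (cov : IsCoveringMap f) (e : f ⁻¹' {x}) :
    FundamentalGroup X e.1 ≃* cov.fibreStabilizer e :=
  (MonoidHom.ofInjective (cov.mapOfEq_injective e.1 e.2)).trans
    (MulEquiv.subgroupCongr (cov.range_mapOfEq e.1 e.2))

theorem exists_lift_of_fibreStabilizer_le [PathConnectedSpace Y] [LocallyPathConnectedSpace Y]
    (covf : IsCoveringMap f) (covg : IsCoveringMap g) (e : f ⁻¹' {x}) (e' : g ⁻¹' {x})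
    (h : covg.fibreStabilizer e' ≤ covf.fibreStabilizer e) :
    ∃ F : C(Y, X), F e' = e ∧ f ∘ F = g := by
  obtain ⟨e', rfl⟩ := e'
  obtain ⟨e, he⟩ := e
  have hmap : (FundamentalGroup.map ⟨g, covg.continuous⟩ e').range =
      covg.fibreStabilizer (⟨e', rfl⟩ : g ⁻¹' {g e'}) := by
    rw [← covg.range_mapOfEq e' rfl]
    congr 1
    ext γ
    rw [FundamentalGroup.mapOfEq_apply, Path.Homotopic.Quotient.cast_rfl_rfl]
    rfl
  obtain ⟨F, hF, -⟩ := covf.existsUnique_continuousMap_lifts_of_range_le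
    (f := ⟨g, covg.continuous⟩) (a₀ := e') (e₀ := e) he (by
      refine hmap.le.trans (h.trans ?_)
      exact (covf.range_mapOfEq e he).ge)
  exact ⟨F, hF⟩

/-- Lift each projection through the other. The composites are lifts fixing a point, hence
identities by uniqueness of lifts. -/
theorem exists_homeomorph_of_fibreStabilizer_eq [PathConnectedSpace X]
    [LocallyPathConnectedSpace X] [PathConnectedSpace Y] [LocallyPathConnectedSpace Y]
    (covf : IsCoveringMap f) (covg : IsCoveringMap g) (e : f ⁻¹' {x}) (e' : g ⁻¹' {x})
    (h : covf.fibreStabilizer e = covg.fibreStabilizer e') :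
    ∃ φ : X ≃ₜ Y, ∀ a, g (φ a) = f a := by
  obtain ⟨F, hFe, hF⟩ := covg.exists_lift_of_fibreStabilizer_le covf e' e h.le
  obtain ⟨G, hGe, hG⟩ := covf.exists_lift_of_fibreStabilizer_le covg e e' h.ge
  have h₁ : G ∘ F = id := covf.eq_of_comp_eq (G.continuous.comp F.continuous) continuous_id
    (by rw [← Function.comp_assoc, hG, hF, Function.comp_id]) e.1 (by simp [hFe, hGe])
  have h₂ : F ∘ G = id := covg.eq_of_comp_eq (F.continuous.comp G.continuous) continuous_id
    (by rw [← Function.comp_assoc, hF, hG, Function.comp_id]) e'.1 (by simp [hFe, hGe])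
  exact ⟨⟨⟨F, G, congrFun h₁, congrFun h₂⟩, F.continuous, G.continuous⟩, congrFun hF⟩

theorem monodromy_comp (covf : IsCoveringMap f) (covg : IsCoveringMap g) {φ : X → Y}
    (hφ : Continuous φ) (h : ∀ a, g (φ a) = f a) {y : M} (γ : Path.Homotopic.Quotient x y)
    (e : f ⁻¹' {x}) :
    covg.monodromy γ ⟨φ e.1, (h e.1).trans e.2⟩ =
      ⟨φ (covf.monodromy γ e).1, (h _).trans (covf.monodromy γ e).2⟩ := by
  obtain ⟨p, rfl⟩ := Path.Homotopic.Quotient.mk_surjective γ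
  refine Subtype.ext ?_
  have hp : (p : C(unitInterval, M)) 0 = f e.1 := p.source.trans e.2.symm
  have := (covg.eq_liftPath_iff (γ := p) (e := φ e.1) (hp.trans (h e.1).symm)
    (Γ := φ ∘ covf.liftPath p e.1 hp)).2 ⟨hφ.comp (ContinuousMap.continuous _), by
      rw [← covf.liftPath_lifts p e.1 hp]
      exact funext fun t => h _, congrArg φ (covf.liftPath_zero p e.1 hp)⟩
  exact (congrFun this 1).symm

theorem fibreStabilizer_of_homeomorph (covf : IsCoveringMap f) (covg : IsCoveringMap g)
    (φ : X ≃ₜ Y) (h : ∀ a, g (φ a) = f a) (e : f ⁻¹' {x}) :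
    covg.fibreStabilizer (⟨φ e.1, (h e.1).trans e.2⟩ : g ⁻¹' {x}) = covf.fibreStabilizer e := by
  ext γ
  rw [mem_fibreStabilizer, mem_fibreStabilizer, monodromy_comp covf covg φ.continuous h,
    Subtype.ext_iff, Subtype.ext_iff]
  exact φ.injective.eq_iff

end IsCoveringMap

end FibreStabilizer

/-! ### Classification of coverings by conjugacy classes -/

namespace NFoldCovering

variable {M : Type u} [TopologicalSpace M] {n : ℕ}

theorem nonempty_fibre (p : NFoldCovering M n) (hn : n ≠ 0) (x : M) :
    Nonempty (p.proj ⁻¹' {x}) := by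
  refine Set.Nonempty.to_subtype (Set.encard_ne_zero.1 ?_)
  rw [p.encard_fibre]
  exact_mod_cast hn

variable [LocallyPathConnectedSpace M]

instance locallyPathConnectedSpace_total (p : NFoldCovering M n) :
    LocallyPathConnectedSpace p.Total :=
  p.isCoveringMap.isLocalHomeomorph.locallyPathConnectedSpace

instance pathConnectedSpace_total (p : NFoldCovering M n) : PathConnectedSpace p.Total :=
  pathConnectedSpace_iff_connectedSpace.2 p.connected

variable {x : M}

theorem index_fibreStabilizer (p : NFoldCovering M n) (e : p.proj ⁻¹' {x}) :
    (p.isCoveringMap.fibreStabilizer e).index = n := by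
  rw [p.isCoveringMap.index_fibreStabilizer, Nat.card_coe_set_eq, Set.ncard, p.encard_fibre]
  rfl

theorem nonempty_abelianization_fibreStabilizer (p : NFoldCovering M n) (e : p.proj ⁻¹' {x}) :
    Nonempty (Additive (Abelianization (p.isCoveringMap.fibreStabilizer e)) ≃+
      firstHomology p.Total) := by
  obtain ⟨φ⟩ := nonempty_abelianization_addEquiv_firstHomology e.1
  exact ⟨(MulEquiv.toAdditive
    (p.isCoveringMap.fundamentalGroupEquiv e).symm.abelianizationCongr).trans φ⟩

/-- An equivalence preserves stabilizers but may send `e` to another point than `e'`; changing the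
point in the fibre by a loop conjugates the stabilizer. -/
theorem equivalent_iff (p q : NFoldCovering M n) (e : p.proj ⁻¹' {x}) (e' : q.proj ⁻¹' {x}) :
    p.Equivalent q ↔ conjIndexSetoid (FundamentalGroup M x) n
      ⟨p.isCoveringMap.fibreStabilizer e, p.index_fibreStabilizer e⟩
      ⟨q.isCoveringMap.fibreStabilizer e', q.index_fibreStabilizer e'⟩ := by
  rw [conjIndexSetoid_iff]
  constructor
  · rintro ⟨φ, hφ⟩
    obtain ⟨γ, hγ⟩ := q.isCoveringMap.exists_monodromy_eq e'
      ⟨φ e.1, (hφ e.1).trans e.2⟩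
    exact ⟨γ, by
      rw [← q.isCoveringMap.fibreStabilizer_monodromy, hγ]
      exact p.isCoveringMap.fibreStabilizer_of_homeomorph q.isCoveringMap φ hφ e⟩
  · rintro ⟨γ, hγ⟩
    rw [← q.isCoveringMap.fibreStabilizer_monodromy] at hγ
    exact p.isCoveringMap.exists_homeomorph_of_fibreStabilizer_eq q.isCoveringMap e _ hγ.symm

/-- Coverings are classified by conjugacy classes of subgroups of the fundamental group. -/
theorem nonempty_coveringClass_equiv [PathConnectedSpace M] (hM : SemilocallySimplyConnected M)
    (x₀ : M) (hn : n ≠ 0) :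
    Nonempty (CoveringClass M n ≃ Quotient (conjIndexSetoid (FundamentalGroup M x₀) n)) := by
  let b (p : NFoldCovering M n) : p.proj ⁻¹' {x₀} := (p.nonempty_fibre hn x₀).some
  let S (p : NFoldCovering M n) : {K : Subgroup (FundamentalGroup M x₀) // K.index = n} :=
    ⟨p.isCoveringMap.fibreStabilizer (b p), p.index_fibreStabilizer (b p)⟩
  have hS : ∀ p q : NFoldCovering M n,
      p.Equivalent q ↔ conjIndexSetoid (FundamentalGroup M x₀) n (S p) (S q) :=
    fun p q => p.equivalent_iff q (b p) (b q)
  refine ⟨Equiv.ofBijective (Quotient.map S fun p q => (hS p q).1) ⟨?_, ?_⟩⟩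
  · rintro ⟨p⟩ ⟨q⟩ h
    exact Quotient.sound ((hS p q).2 (Quotient.exact h))
  · rintro ⟨K, hK⟩
    obtain ⟨p, e, he⟩ := exists_nFoldCovering hM x₀ hn K hK
    have hK' : p.isCoveringMap.fibreStabilizer e = K := by
      ext γ
      exact he γ
    refine ⟨Quotient.mk _ p, Quotient.sound ?_⟩
    -- The chosen point `b p` may differ from `e`; comparing `p` with itself shows that their
    -- stabilizers are conjugate.
    have := (p.equivalent_iff p (b p) e).1 (equivalent_equivalence.refl p)
    simpa only [hK'] using this

end NFoldCovering

/-! ### Summation over isomorphism classes of homology groups -/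

theorem finsum_mem_range_mul_card_fiber {ι κ : Type*} [Finite ι] (c : ι → κ) (g : κ → ℚ) :
    ∑ᶠ k ∈ Set.range c, g k * Nat.card {i // c i = k} = ∑ᶠ i, g (c i) := by
  classical
  have := Fintype.ofFinite ι
  rw [finsum_eq_sum_of_fintype fun i => g (c i), Finset.sum_comp, ← finsum_mem_coe_finset]
  refine finsum_mem_congr (by simp) fun k _ => ?_
  rw [Nat.card_eq_fintype_card, Fintype.card_subtype, nsmul_eq_mul, mul_comm]

theorem finite_addMonoidHom_zmod {G : Type*} [Group G] [Group.FG G] (d : ℕ) (hd : 1 ≤ d) :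
    Finite (Additive (Abelianization G) →+ ZMod d) := by
  have : NeZero d := ⟨by lia⟩
  have : Group.FG (Abelianization G) := Group.fg_of_surjective (QuotientGroup.mk'_surjective _)
  have := MonoidHom.finite_of_fg (G := Abelianization G) (P := Multiplicative (ZMod d))
  exact Finite.of_equiv _ (MonoidHom.toAdditiveLeft (α := Abelianization G) (β := ZMod d))

namespace AbGroupClass

theorem mk_eq_mk_iff {A B : AddCommGrpCat.{u}} : mk A = mk B ↔ Nonempty (A ≃+ B) := by
  refine Quotient.eq.trans ⟨?_, ?_⟩
  · rintro ⟨e⟩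
    exact ⟨e.addCommGroupIsoToAddEquiv⟩
  · rintro ⟨e⟩
    exact ⟨e.toAddCommGrpIso⟩

theorem mk_eq_iff {A : AddCommGrpCat.{u}} {H : AbGroupClass.{u}} :
    mk A = H ↔ Nonempty (A ≃+ H.rep) := by
  rw [← mk_eq_mk_iff]
  exact ⟨fun h => h.trans (Quotient.out_eq H).symm, fun h => h.trans (Quotient.out_eq H)⟩

/-- The isomorphism class of the abelianization of a group. -/
def ofGroup (G : Type u) [Group G] : AbGroupClass.{u} :=
  mk (AddCommGrpCat.of (Additive (Abelianization G)))

theorem ofGroup_eq_iff {G : Type u} [Group G] {H : AbGroupClass.{u}} :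
    ofGroup G = H ↔ Nonempty (Additive (Abelianization G) ≃+ H.rep) :=
  mk_eq_iff

theorem nonempty_rep_addEquiv (G : Type u) [Group G] :
    Nonempty (Additive (Abelianization G) ≃+ (ofGroup G).rep) :=
  ofGroup_eq_iff.1 rfl

end AbGroupClass

/-- Summing over isomorphism classes of abelianizations amounts to summing over subgroups. -/
theorem finsum_homology_eq_finsum_subgroup {G : Type u} [Group G] [Group.FG G] {l m : ℕ}
    (hl : 0 < l) (hm : m ≠ 0) :
    (∑ᶠ H ∈ Set.range fun F : {F : Subgroup G // F.index = m} => AbGroupClass.ofGroup F.1,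
      ∑ d ∈ l.divisors, (ArithmeticFunction.moebius (l / d) : ℚ) *
        (Nat.card (H.rep →+ ZMod d) : ℚ) * (numSubgroupsWithHomology G H.rep m : ℚ)) =
      ((∑ᶠ F : {F : Subgroup G // F.index = m},
        Nat.card {ψ : Additive (Abelianization F.1) →+ ZMod l // Function.Surjective ψ} : ℕ) : ℚ)
      := by
  have := (Subgroup.finite_setOf_index_eq (G := G) hm).to_subtype
  have hfin : Finite {F : Subgroup G // F.index = m} := this
  -- Finite-index subgroups of a finitely generated group are finitely generated, so Hom(F/[F,F],
  -- Z_d) is finite and Möbius inversion applies.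
  have hfg (F : {F : Subgroup G // F.index = m}) : Group.FG F.1 :=
    have : F.1.FiniteIndex := ⟨F.2.trans_ne hm⟩
    inferInstance
  have hcard (H : AbGroupClass.{u}) : numSubgroupsWithHomology G H.rep m =
      Nat.card {F : {F : Subgroup G // F.index = m} // AbGroupClass.ofGroup F.1 = H} := by
    refine Nat.card_congr ((Equiv.subtypeSubtypeEquivSubtypeInter _
      fun F : Subgroup G => AbGroupClass.ofGroup F = H).trans
      (Equiv.subtypeEquivRight fun F => ?_)).symm
    rw [AbGroupClass.ofGroup_eq_iff]
  simp_rw [← Finset.sum_mul, hcard]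
  rw [finsum_mem_range_mul_card_fiber
    (fun F : {F : Subgroup G // F.index = m} => AbGroupClass.ofGroup F.1)
    fun H => ∑ d ∈ l.divisors, (ArithmeticFunction.moebius (l / d) : ℚ) *
        (Nat.card (H.rep →+ ZMod d) : ℚ)]
  have := Fintype.ofFinite {F : Subgroup G // F.index = m}
  rw [finsum_eq_sum_of_fintype, finsum_eq_sum_of_fintype, Nat.cast_sum]
  refine Finset.sum_congr rfl fun F _ => ?_
  rw [← sum_moebius_mul_card_addMonoidHom hl fun d hd => finite_addMonoidHom_zmod d hd]
  refine Finset.sum_congr rfl fun d _ => ?_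
  obtain ⟨e⟩ := AbGroupClass.nonempty_rep_addEquiv F.1
  rw [Nat.card_congr (e.addMonoidHomCongrLeftEquiv (N := ZMod d))]

namespace NFoldCovering

variable {M : Type u} [TopologicalSpace M] [LocallyPathConnectedSpace M]

/-- By Hurewicz a covering has the abelianized fibre stabilizer as first homology, and every
subgroup of index `m` is such a stabilizer. -/
theorem coveringHomologies_eq_range [PathConnectedSpace M] (hM : SemilocallySimplyConnected M)
    (x₀ : M) {m : ℕ} (hm : m ≠ 0) :
    coveringHomologies M m =
      Set.range fun F : {F : Subgroup (FundamentalGroup M x₀) // F.index = m} =>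
        AbGroupClass.ofGroup F.1 := by
  ext H
  constructor
  · rintro ⟨p, rfl⟩
    obtain ⟨e⟩ := p.nonempty_fibre hm x₀
    exact ⟨⟨_, p.index_fibreStabilizer e⟩,
      AbGroupClass.mk_eq_mk_iff.2 (p.nonempty_abelianization_fibreStabilizer e)⟩
  · rintro ⟨⟨F, hF⟩, rfl⟩
    obtain ⟨p, e, he⟩ := exists_nFoldCovering hM x₀ hm F hF
    have hF' : p.isCoveringMap.fibreStabilizer e = F := by
      ext γ
      exact he γ
    subst hF'
    exact ⟨p, (AbGroupClass.mk_eq_mk_iff.2 (p.nonempty_abelianization_fibreStabilizer e)).symm⟩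

end NFoldCovering

/-! ### The counting formula -/

theorem theorem7 {E : Type*} [NormedAddCommGroup E] [NormedSpace ℝ E]
    {B : Type*} [TopologicalSpace B] (I : ModelWithCorners ℝ E B)
    (M : Type u) [TopologicalSpace M] [ChartedSpace B M] [IsManifold I 0 M] [ConnectedSpace M]
    (x₀ : M) [Group.FG (FundamentalGroup M x₀)] (n : ℕ) (hn : 1 ≤ n) :
    Finite (CoveringClass M n) ∧
    (∀ m ∈ n.divisors,
      (coveringHomologies M m).Finite ∧
      {F : Subgroup (FundamentalGroup M x₀) | F.index = m}.Finite ∧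
      ∀ H ∈ coveringHomologies M m, ∀ d : ℕ, 1 ≤ d → Finite (H.rep →+ ZMod d)) ∧
    (numCoverings M n : ℚ) =
      (1 / (n : ℚ)) * ∑ lm ∈ n.divisorsAntidiagonal,
        ∑ᶠ H ∈ coveringHomologies M lm.2, ∑ d ∈ lm.1.divisors,
          (ArithmeticFunction.moebius (lm.1 / d) : ℚ) * (Nat.card (H.rep →+ ZMod d) : ℚ) *
            (numSubgroupsWithHomology (FundamentalGroup M x₀) H.rep lm.2 : ℚ) := by
  have hn₀ : n ≠ 0 := by lia
  have := I.locallyPathConnectedSpace_manifold M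
  have : PathConnectedSpace M := pathConnectedSpace_iff_connectedSpace.2 inferInstance
  have hM := I.semilocallySimplyConnected M
  have hfin (m : ℕ) (hm : m ≠ 0) : Finite {F : Subgroup (FundamentalGroup M x₀) // F.index = m} :=
    (Subgroup.finite_setOf_index_eq hm).to_subtype
  obtain ⟨φ⟩ := NFoldCovering.nonempty_coveringClass_equiv hM x₀ hn₀
  refine ⟨?_, fun m hm => ?_, ?_⟩
  -- The finiteness claims ensure that `Nat.card` and `∑ᶠ` in the formula are genuine counts and
  -- sums, not default zeros.
  · have := hfin n hn₀
    exact Finite.of_equiv _ φ.symm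
  · have hm₀ : m ≠ 0 := (Nat.pos_of_mem_divisors hm).ne'
    have := hfin m hm₀
    rw [NFoldCovering.coveringHomologies_eq_range hM x₀ hm₀]
    refine ⟨Set.finite_range _, Subgroup.finite_setOf_index_eq hm₀, ?_⟩
    rintro _ ⟨F, rfl⟩ d hd
    have : F.1.FiniteIndex := ⟨F.2.trans_ne hm₀⟩
    have := finite_addMonoidHom_zmod (G := F.1) d hd
    obtain ⟨e⟩ := AbGroupClass.nonempty_rep_addEquiv F.1
    exact Finite.of_equiv _ (e.addMonoidHomCongrLeftEquiv (N := ZMod d))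
  · have key := card_conj_index_eq_sum (G := FundamentalGroup M x₀) hn₀
    rw [← Nat.card_congr φ] at key
    have hq : (n : ℚ) ≠ 0 := by exact_mod_cast hn₀
    rw [one_div, eq_inv_mul_iff_mul_eq₀ hq, numCoverings, ← Nat.cast_mul, key, Nat.cast_sum]
    refine Finset.sum_congr rfl fun lm hlm => ?_
    have hlm' := Nat.mem_divisorsAntidiagonal.1 hlm
    have hl : lm.1 ≠ 0 := fun h => hlm'.2 (by rw [← hlm'.1, h, zero_mul])
    have hm : lm.2 ≠ 0 := fun h => hlm'.2 (by rw [← hlm'.1, h, mul_zero])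
    rw [NFoldCovering.coveringHomologies_eq_range hM x₀ hm,
      finsum_homology_eq_finsum_subgroup (Nat.pos_of_ne_zero hl) hm]
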